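/- Let $p_j=\tfrac14$ for integers $j\ge 0$ and $p_j=\tfrac12$ for integers $j<0$. The Half-Plane Half-Comb (HPHC) walk is the Markov chain $\mathbf C(N)$, $N=0,1,2,\ldots$, on $\mathbb Z^2$ with $\mathbf C(0)=(0,0)$ that moves from $(k,j)$ to each of $(k+1,j)$ and $(k-1,j)$ with probability $\tfrac12-p_j$, and to each of $(k,j+1)$ and $(k,j-1)$ with probability $p_j$. Its local time at $(k,j)\in\mathbb Z^2$ up to time $N$ is $$\Xi((k,j),N)=\sum_{r=0}^{N} I\{\mathbf C(r)=(k,j)\}.$$ Then for all integers $k_1,k_2,j_1,j_2$: $$\lim_{N\to\infty}\frac{\Xi((k_1,j_1),N)}{\Xi((k_2,j_2),N)}=1\quad\text{a.s.}\qquad\text{if } j_1\ge 0,\ j_2\ge 0\ \text{ or }\ j_1<0,\ j_2<0,$$ and $$\lim_{N\to\infty}\frac{\Xi((k_1,j_1),N)}{\Xi((k_2,j_2),N)}=2\quad\text{a.s.}\qquad\text{if } j_1\ge 0,\ j_2<0.$$ -/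

import Mathlib

open MeasureTheory ProbabilityTheory Filter Topology

noncomputable section

/-- One-step transition probabilities of the anisotropic walk on `ℤ²` with parameters `p`: from
`(k, j)` each horizontal neighbour is chosen with probability `1/2 - p j` and each vertical
neighbour with probability `p j`. -/
def anisotropicStep (p : ℤ → ℝ) (x y : ℤ × ℤ) : ℝ :=
  if y = (x.1 + 1, x.2) ∨ y = (x.1 - 1, x.2) then 1 / 2 - p x.2
  else if y = (x.1, x.2 + 1) ∨ y = (x.1, x.2 - 1) then p x.2
  else 0

/-- `C` is the anisotropic random walk with parameters `p` on the probability space `(Ω, P)`: a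
Markov chain on `ℤ²` started from the origin, with transition probabilities `anisotropicStep p`.
The Markov property is stated by conditioning on every history of positive probability. -/
structure IsAnisotropicWalk {Ω : Type*} [MeasurableSpace Ω] (P : Measure Ω) (p : ℤ → ℝ)
    (C : ℕ → Ω → ℤ × ℤ) : Prop where
  measurable : ∀ n, Measurable (C n)
  start : ∀ᵐ ω ∂P, C 0 ω = (0, 0)
  transition : ∀ (n : ℕ) (x : ℕ → ℤ × ℤ), P {ω | ∀ i ≤ n, C i ω = x i} ≠ 0 →
    ∀ y : ℤ × ℤ, P[{ω | C (n + 1) ω = y} | {ω | ∀ i ≤ n, C i ω = x i}] =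
      ENNReal.ofReal (anisotropicStep p (x n) y)

/-- Half-Plane Half-Comb parameters: square lattice for `j ≥ 0`, comb for `j < 0`. -/
def hphcParam (j : ℤ) : ℝ := if 0 ≤ j then 1 / 4 else 1 / 2

/-- `C` is the Half-Plane Half-Comb walk on `(Ω, P)`. -/
def IsHPHCWalk {Ω : Type*} [MeasurableSpace Ω] (P : Measure Ω) (C : ℕ → Ω → ℤ × ℤ) : Prop :=
  IsAnisotropicWalk P hphcParam C

/-- Local time at `x` up to time `N`: the number of `r ∈ {0, …, N}` with `C r ω = x`. -/
def localTime {Ω : Type*} (C : ℕ → Ω → ℤ × ℤ) (x : ℤ × ℤ) (N : ℕ) (ω : Ω) : ℕ :=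
  ∑ r ∈ Finset.range (N + 1), if C r ω = x then 1 else 0

end

/-! The walk is reversible with respect to `m (k, j) = 1 / p j`, which is 4 on the upper half-plane
and 2 on the comb. It is recurrent, so local times should grow in proportion to `m`, which gives the
limits 1 and 2.

The ratio limit is proved by a martingale argument rather than by excursion decomposition. Write `T`
for the transition operator. For adjacent `x`, `y` there is a bounded `h` with `h - T h = δ_y / m y
- δ_x / m x` (`exists_bounded_dipole`): it is a limit of differences of killed Green functions,
bounded uniformly through their Dirichlet energy. Along the path, `∑ (h (C (r+1)) - T h (C r))`
equals, up to a bounded term, `visits y / m y - visits x / m x`. Discounting each increment by the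
inverse of the number of visits to `x` and `y` so far yields an `L²`-bounded, hence convergent,
martingale (`integral_dipoleMartingale_sq_le`). Kronecker's lemma then makes the difference
negligible against the number of visits, and ratios are chained along lattice paths
(`hasVisitRatio`).

This needs only one point visited infinitely often, possibly random. Such a point comes from a
Lyapunov function with finite sublevel sets, superharmonic off a finite set: a corrected logarithm
above, affine along each tooth below. -/

noncomputable section

/-! ### Transition operator and Markov property -/

/-- The four lattice neighbours of a point of `ℤ²`. -/
def latticeNbrs (z : ℤ × ℤ) : Finset (ℤ × ℤ) :=
  {(z.1 + 1, z.2), (z.1 - 1, z.2), (z.1, z.2 + 1), (z.1, z.2 - 1)}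

/-- The one-step transition operator of the anisotropic walk. -/
def stepOp (p : ℤ → ℝ) (f : ℤ × ℤ → ℝ) (z : ℤ × ℤ) : ℝ :=
  ∑ y ∈ latticeNbrs z, anisotropicStep p z y * f y

theorem stepOp_eq (p : ℤ → ℝ) (f : ℤ × ℤ → ℝ) (z : ℤ × ℤ) :
    stepOp p f z = (1 / 2 - p z.2) * (f (z.1 + 1, z.2) + f (z.1 - 1, z.2)) +
      p z.2 * (f (z.1, z.2 + 1) + f (z.1, z.2 - 1)) := by
  unfold stepOp latticeNbrs
  have e1 : z.1 + 1 ≠ z.1 - 1 := by omega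
  have e2 : z.2 + 1 ≠ z.2 - 1 := by omega
  rw [Finset.sum_insert, Finset.sum_insert, Finset.sum_insert, Finset.sum_singleton]
  · simp [anisotropicStep]
    ring
  · simp [e2]
  · simp
  · simp [e1]

theorem anisotropicStep_nonneg {p : ℤ → ℝ} (h0 : ∀ j, 0 ≤ p j) (h1 : ∀ j, p j ≤ 1 / 2)
    (z y : ℤ × ℤ) : 0 ≤ anisotropicStep p z y := by
  unfold anisotropicStep
  split_ifs
  · linarith [h1 z.2]
  · exact h0 _
  · exact le_rfl

theorem anisotropicStep_eq_zero {p : ℤ → ℝ} {z y : ℤ × ℤ} (h : y ∉ latticeNbrs z) :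
    anisotropicStep p z y = 0 := by
  simp only [latticeNbrs, Finset.mem_insert, Finset.mem_singleton, not_or] at h
  simp [anisotropicStep, h]

theorem sum_anisotropicStep (p : ℤ → ℝ) (z : ℤ × ℤ) :
    ∑ y ∈ latticeNbrs z, anisotropicStep p z y = 1 := by
  have := stepOp_eq p (fun _ => 1) z
  simp only [stepOp, mul_one] at this
  rw [this]; ring

theorem stepOp_mono {p : ℤ → ℝ} (h0 : ∀ j, 0 ≤ p j) (h1 : ∀ j, p j ≤ 1 / 2)
    {f g : ℤ × ℤ → ℝ} (hfg : ∀ z, f z ≤ g z) (z : ℤ × ℤ) : stepOp p f z ≤ stepOp p g z :=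
  Finset.sum_le_sum fun y _ => mul_le_mul_of_nonneg_left (hfg y) (anisotropicStep_nonneg h0 h1 z y)

theorem stepOp_const (p : ℤ → ℝ) (c : ℝ) (z : ℤ × ℤ) : stepOp p (fun _ => c) z = c := by
  rw [stepOp, ← Finset.sum_mul, sum_anisotropicStep, one_mul]

theorem abs_stepOp_le {p : ℤ → ℝ} (h0 : ∀ j, 0 ≤ p j) (h1 : ∀ j, p j ≤ 1 / 2)
    {f : ℤ × ℤ → ℝ} {B : ℝ} (hf : ∀ z, |f z| ≤ B) (z : ℤ × ℤ) : |stepOp p f z| ≤ B := by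
  rw [abs_le]
  constructor
  · rw [← stepOp_const p (-B) z]
    exact stepOp_mono h0 h1 (fun z => (abs_le.1 (hf z)).1) z
  · rw [← stepOp_const p B z]
    exact stepOp_mono h0 h1 (fun z => (abs_le.1 (hf z)).2) z

section Markov

variable {Ω : Type*} [MeasurableSpace Ω]

/-- The history of the process `C` up to time `n`. -/
def history (C : ℕ → Ω → ℤ × ℤ) (n : ℕ) (ω : Ω) : Fin (n + 1) → ℤ × ℤ := fun i => C i ω

theorem measurable_history {C : ℕ → Ω → ℤ × ℤ} (hC : ∀ n, Measurable (C n)) (n : ℕ) :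
    Measurable (history C n) :=
  measurable_pi_lambda _ fun i => hC i

/-- The filtration generated by the histories of `C`. -/
def historyFiltration (C : ℕ → Ω → ℤ × ℤ) (hC : ∀ n, Measurable (C n)) :
    Filtration ℕ (inferInstance : MeasurableSpace Ω) where
  seq n := MeasurableSpace.comap (history C n) inferInstance
  mono' := by
    intro n m hnm
    have h : history C n = (fun v : Fin (m + 1) → ℤ × ℤ =>
        fun i : Fin (n + 1) => v ⟨i, by have := i.2; omega⟩) ∘ history C m := rfl
    show MeasurableSpace.comap (history C n) inferInstance ≤
      MeasurableSpace.comap (history C m) inferInstance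
    rw [h, ← MeasurableSpace.comap_comp]
    refine MeasurableSpace.comap_mono ?_
    exact Measurable.comap_le (by fun_prop)
  le' n := (measurable_history hC n).comap_le

theorem measurable_historyFiltration {C : ℕ → Ω → ℤ × ℤ} (hC : ∀ n, Measurable (C n)) {i n : ℕ}
    (hin : i ≤ n) : Measurable[historyFiltration C hC n] (C i) := by
  have h : C i = (fun v : Fin (n + 1) → ℤ × ℤ => v ⟨i, by omega⟩) ∘ history C n := rfl
  rw [h]
  exact Measurable.comp (by fun_prop) (comap_measurable _)

variable {P : Measure Ω} [IsProbabilityMeasure P] {p : ℤ → ℝ} {C : ℕ → Ω → ℤ × ℤ}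

theorem IsAnisotropicWalk.measure_history_inter (hC : IsAnisotropicWalk P p C)
    (n : ℕ) (v : Fin (n + 1) → ℤ × ℤ) (y : ℤ × ℤ) :
    P (history C n ⁻¹' {v} ∩ C (n + 1) ⁻¹' {y}) =
      P (history C n ⁻¹' {v}) * ENNReal.ofReal (anisotropicStep p (v (Fin.last n)) y) := by
  have hm := measurable_history hC.measurable n (measurableSet_singleton v)
  by_cases h0 : P (history C n ⁻¹' {v}) = 0
  · rw [h0, zero_mul]
    exact measure_mono_null Set.inter_subset_left h0
  -- The Markov hypothesis takes an infinite sequence; only its first `n + 1` entries matter, so the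
  -- tail is filled with 0.
  set x : ℕ → ℤ × ℤ := fun i => if h : i < n + 1 then v ⟨i, h⟩ else 0 with hx
  have hset : {ω | ∀ i ≤ n, C i ω = x i} = history C n ⁻¹' {v} := by
    ext ω
    simp only [Set.mem_ofPred_eq, Set.mem_preimage, Set.mem_singleton_iff, funext_iff, history, hx]
    constructor
    · intro h i
      have hi := i.2
      have := h i (by omega)
      rwa [dif_pos hi] at this
    · intro h i hi
      rw [dif_pos (by omega)]
      exact h ⟨i, by omega⟩
  have ht := hC.transition n x (by rwa [hset]) y
  rw [hset, cond_apply hm] at ht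
  have hxn : x n = v (Fin.last n) := by simp [hx, Fin.last]
  rw [hxn] at ht
  rw [← ht, ← mul_assoc, ENNReal.mul_inv_cancel h0 (measure_ne_top _ _), one_mul]
  rfl

theorem IsAnisotropicWalk.setIntegral_history (hC : IsAnisotropicWalk P p C)
    (h0 : ∀ j, 0 ≤ p j) (h1 : ∀ j, p j ≤ 1 / 2) (f : ℤ × ℤ → ℝ)
    (n : ℕ) (v : Fin (n + 1) → ℤ × ℤ) :
    ∫ ω in history C n ⁻¹' {v}, f (C (n + 1) ω) ∂P =
      ∫ ω in history C n ⁻¹' {v}, stepOp p f (C n ω) ∂P := by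
  set A := history C n ⁻¹' {v} with hA
  have hm : MeasurableSet A := measurable_history hC.measurable n (measurableSet_singleton v)
  have hmy : ∀ y, MeasurableSet (C (n + 1) ⁻¹' {y}) := fun y =>
    hC.measurable _ (measurableSet_singleton y)
  set z := v (Fin.last n) with hz
  have hy : ∀ y, (P.restrict A) (C (n + 1) ⁻¹' {y}) =
      P A * ENNReal.ofReal (anisotropicStep p z y) := by
    intro y
    rw [Measure.restrict_apply (hmy y), Set.inter_comm]
    exact hC.measure_history_inter n v y
  have hyr : ∀ y, (P.restrict A).real (C (n + 1) ⁻¹' {y}) = P.real A * anisotropicStep p z y := by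
    intro y
    rw [Measure.real, hy, ENNReal.toReal_mul,
      ENNReal.toReal_ofReal (anisotropicStep_nonneg h0 h1 _ _), Measure.real]
  have hR : ∫ ω in A, stepOp p f (C n ω) ∂P = P.real A * stepOp p f z := by
    have : ∫ ω in A, stepOp p f (C n ω) ∂P = ∫ ω in A, stepOp p f z ∂P := by
      refine setIntegral_congr_fun hm fun ω hω => ?_
      have : C n ω = z := congrFun hω (Fin.last n)
      simp only [this]
    rw [this]; simp
  -- The four neighbours carry total transition mass one, so almost surely the next position is one
  -- of them and `f` reduces to a finite sum.
  have hae : ∀ᵐ ω ∂(P.restrict A), C (n + 1) ω ∈ latticeNbrs z := by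
    have hms : MeasurableSet {ω | C (n + 1) ω ∈ latticeNbrs z} :=
      hC.measurable _ (Finset.measurableSet _)
    have : (P.restrict A) {ω | C (n + 1) ω ∈ latticeNbrs z} = (P.restrict A) Set.univ := by
      have hU : {ω | C (n + 1) ω ∈ latticeNbrs z} = ⋃ y ∈ latticeNbrs z, C (n + 1) ⁻¹' {y} := by
        ext ω; simp
      rw [hU, measure_biUnion_finset]
      · simp_rw [hy]
        rw [← Finset.mul_sum, ← ENNReal.ofReal_sum_of_nonneg
          (fun y _ => anisotropicStep_nonneg h0 h1 _ _), sum_anisotropicStep]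
        simp
      · intro a _ b _ hab
        exact Disjoint.preimage _ (by simpa using hab)
      · exact fun y _ => hmy y
    rw [ae_iff]
    have hc := measure_compl hms (measure_ne_top (P.restrict A) _)
    rw [this, tsub_self] at hc
    exact hc
  have hf : ∀ᵐ ω ∂(P.restrict A), f (C (n + 1) ω) =
      ∑ y ∈ latticeNbrs z, (C (n + 1) ⁻¹' {y}).indicator (fun _ => f y) ω := by
    filter_upwards [hae] with ω hω
    rw [Finset.sum_eq_single (C (n + 1) ω)]
    · simp
    · intro b _ hb
      simp [Set.indicator, hb.symm]
    · exact fun h => absurd hω h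
  rw [hR, integral_congr_ae hf, integral_finsetSum]
  · rw [stepOp, Finset.mul_sum]
    refine Finset.sum_congr rfl fun y _ => ?_
    rw [integral_indicator_const _ (hmy y), hyr, smul_eq_mul]
    ring
  · exact fun y _ => (integrable_const _).indicator (hmy y)

theorem integrable_comp_of_bounded {f : ℤ × ℤ → ℝ} {B : ℝ} (hf : ∀ z, |f z| ≤ B)
    {X : Ω → ℤ × ℤ} (hX : Measurable X) : Integrable (fun ω => f (X ω)) P :=
  Integrable.of_bound ((measurable_of_countable f).comp hX).aestronglyMeasurable B
    (Eventually.of_forall fun _ => hf _)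

theorem IsAnisotropicWalk.condExp_comp (hC : IsAnisotropicWalk P p C)
    (h0 : ∀ j, 0 ≤ p j) (h1 : ∀ j, p j ≤ 1 / 2) {f : ℤ × ℤ → ℝ} {B : ℝ} (hf : ∀ z, |f z| ≤ B)
    (n : ℕ) :
    P[fun ω => f (C (n + 1) ω) | historyFiltration C hC.measurable n] =ᵐ[P]
      fun ω => stepOp p f (C n ω) := by
  have hi1 := integrable_comp_of_bounded (P := P) hf (hC.measurable (n + 1))
  have hi2 := integrable_comp_of_bounded (P := P) (abs_stepOp_le h0 h1 hf) (hC.measurable n)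
  symm
  refine ae_eq_condExp_of_forall_setIntegral_eq ((historyFiltration C hC.measurable).le n) hi1
    (fun s _ _ => hi2.integrableOn) ?_ ?_
  · rintro s ⟨T, hT, rfl⟩ -
    -- Histories take countably many values, so every event of the σ-algebra is a countable disjoint
    -- union of single-history events.
    have hU : history C n ⁻¹' T = ⋃ v : T, history C n ⁻¹' {v.1} := by
      ext ω; simp
    have hmv : ∀ v : T, MeasurableSet (history C n ⁻¹' {v.1}) := fun v =>
      measurable_history hC.measurable n (measurableSet_singleton _)
    have hd : Pairwise (Function.onFun Disjoint fun v : T => history C n ⁻¹' {v.1}) := by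
      intro a b hab
      refine Disjoint.preimage _ ?_
      simpa using fun h => hab (Subtype.ext h)
    rw [hU, integral_iUnion hmv hd hi2.integrableOn, integral_iUnion hmv hd hi1.integrableOn]
    exact tsum_congr fun v => (hC.setIntegral_history h0 h1 f n v.1).symm
  · refine Measurable.aestronglyMeasurable ?_
    exact (measurable_of_countable (stepOp p f)).comp (measurable_historyFiltration hC.measurable le_rfl)

theorem IsAnisotropicWalk.integral_mul_comp (hC : IsAnisotropicWalk P p C)
    (h0 : ∀ j, 0 ≤ p j) (h1 : ∀ j, p j ≤ 1 / 2) {f : ℤ × ℤ → ℝ} {B : ℝ} (hf : ∀ z, |f z| ≤ B)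
    {n : ℕ} {g : Ω → ℝ} (hg : Measurable[historyFiltration C hC.measurable n] g) {K : ℝ}
    (hgK : ∀ ω, |g ω| ≤ K) :
    ∫ ω, g ω * f (C (n + 1) ω) ∂P = ∫ ω, g ω * stepOp p f (C n ω) ∂P := by
  have hle := (historyFiltration C hC.measurable).le n
  have hi1 := integrable_comp_of_bounded (P := P) hf (hC.measurable (n + 1))
  rw [← integral_condExp hle]
  refine integral_congr_ae ?_
  have h2 := condExp_stronglyMeasurable_mul_of_bound hle (μ := P) (f := g)
    (g := fun ω => f (C (n + 1) ω)) hg.stronglyMeasurable hi1 K (Eventually.of_forall hgK)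
  refine h2.trans ?_
  filter_upwards [hC.condExp_comp h0 h1 hf n] with ω hω
  simp [hω]

end Markov
end

/-! ### Reversibility, killed Green functions and bounded dipole potentials -/

noncomputable section

/-- The reversible measure of the anisotropic walk with parameters `p`. -/
def reversibleWeight (p : ℤ → ℝ) (z : ℤ × ℤ) : ℝ := (p z.2)⁻¹

section Dipole

variable {p : ℤ → ℝ}

theorem reversibleWeight_pos (h0 : ∀ j, 0 < p j) (z : ℤ × ℤ) : 0 < reversibleWeight p z :=
  inv_pos.2 (h0 _)

/-- Horizontal moves keep the row, hence the weight; every vertical edge has conductance `(p j)⁻¹ *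
p j = 1`, whatever the rows. -/
theorem reversibleWeight_mul_step_comm (h0 : ∀ j, 0 < p j) (z w : ℤ × ℤ) :
    reversibleWeight p z * anisotropicStep p z w =
      reversibleWeight p w * anisotropicStep p w z := by
  obtain ⟨a, b⟩ := z
  obtain ⟨c, d⟩ := w
  have hb := (h0 b).ne'
  have hd := (h0 d).ne'
  simp only [reversibleWeight, anisotropicStep, Prod.mk.injEq]
  by_cases hbd : d = b
  · subst hbd
    by_cases hac : c = a + 1 ∨ c = a - 1
    · have : a = c + 1 ∨ a = c - 1 := by omega
      simp [hac, this]
    · have : ¬ (a = c + 1 ∨ a = c - 1) := by omega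
      have e2 : ¬ (d = d - 1) := by omega
      simp [hac, this, e2]
  · have hdb : ¬ b = d := fun h => hbd h.symm
    by_cases hv : c = a ∧ (d = b + 1 ∨ d = b - 1)
    · have h1 : (c = a ∧ d = b + 1 ∨ c = a ∧ d = b - 1) := by tauto
      have h2 : (a = c ∧ b = d + 1 ∨ a = c ∧ b = d - 1) := by omega
      simp [hbd, hdb, h1, h2, inv_mul_cancel₀ hb, inv_mul_cancel₀ hd]
    · have h1 : ¬ (c = a ∧ d = b + 1 ∨ c = a ∧ d = b - 1) := by tauto
      have h2 : ¬ (a = c ∧ b = d + 1 ∨ a = c ∧ b = d - 1) := by omega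
      simp [hbd, hdb, h1, h2]

theorem anisotropicStep_self (p : ℤ → ℝ) (z : ℤ × ℤ) : anisotropicStep p z z = 0 := by
  apply anisotropicStep_eq_zero
  simp only [latticeNbrs, Finset.mem_insert, Finset.mem_singleton, Prod.ext_iff]
  omega

theorem sum_step_mul_extend (B : Finset (ℤ × ℤ)) (H : ℤ × ℤ → ℝ) (hH : ∀ w ∉ B, H w = 0)
    (z : ℤ × ℤ) : ∑ w : B, anisotropicStep p z w * H w = stepOp p H z := by
  rw [Finset.sum_coe_sort B (fun w => anisotropicStep p z w * H w), stepOp]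
  rw [Finset.sum_subset (Finset.subset_union_left (s₂ := latticeNbrs z)),
    ← Finset.sum_subset (Finset.subset_union_right (s₁ := B))]
  · intro w _ hw
    rw [anisotropicStep_eq_zero hw, zero_mul]
  · intro w _ hw
    rw [hH w hw, mul_zero]

theorem sum_step_le_one (h0 : ∀ j, 0 < p j) (h1 : ∀ j, p j ≤ 1 / 2) (B : Finset (ℤ × ℤ))
    (z : ℤ × ℤ) : ∑ w : B, anisotropicStep p z w ≤ 1 := by
  have h := sum_step_mul_extend (p := p) B (fun w => if w ∈ B then 1 else 0)
    (fun w hw => if_neg hw) z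
  have h2 : stepOp p (fun w => if w ∈ B then 1 else 0) z ≤ 1 := by
    refine (stepOp_mono (g := fun _ => 1) (fun j => (h0 j).le) h1 (fun w => ?_) z).trans_eq
      (stepOp_const p 1 z)
    split_ifs <;> norm_num
  rw [← h] at h2
  simpa using h2

/-- The symmetric matrix of the killed, discounted Laplacian on a finite set. -/
def killedLaplacian (p : ℤ → ℝ) (l : ℝ) (B : Finset (ℤ × ℤ)) : Matrix B B ℝ :=
  fun z w => reversibleWeight p z * ((if z = w then 1 else 0) - l * anisotropicStep p z w)

theorem killedLaplacian_transpose (h0 : ∀ j, 0 < p j) (l : ℝ) (B : Finset (ℤ × ℤ)) :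
    (killedLaplacian p l B).transpose = killedLaplacian p l B := by
  ext z w
  simp only [Matrix.transpose_apply, killedLaplacian, mul_sub]
  congr 1
  · by_cases h : z = w
    · subst h; rfl
    · rw [if_neg h, if_neg (Ne.symm h)]; simp
  · rw [mul_left_comm, reversibleWeight_mul_step_comm h0, mul_left_comm]

theorem killedLaplacian_det_ne_zero (h0 : ∀ j, 0 < p j) (h1 : ∀ j, p j ≤ 1 / 2) {l : ℝ}
    (hl0 : 0 ≤ l) (hl1 : l < 1) (B : Finset (ℤ × ℤ)) : (killedLaplacian p l B).det ≠ 0 := by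
  apply det_ne_zero_of_sum_row_lt_diag
  intro z
  have hm := reversibleWeight_pos h0 (z : ℤ × ℤ)
  have hd : killedLaplacian p l B z z = reversibleWeight p z := by
    simp [killedLaplacian, anisotropicStep_self]
  have hs : ∀ w : B, 0 ≤ anisotropicStep p z w := fun w =>
    anisotropicStep_nonneg (fun j => (h0 j).le) h1 _ _
  rw [hd, Real.norm_of_nonneg hm.le]
  calc ∑ w ∈ Finset.univ.erase z, ‖killedLaplacian p l B z w‖
      = ∑ w ∈ Finset.univ.erase z, reversibleWeight p z * (l * anisotropicStep p z w) := by
        refine Finset.sum_congr rfl fun w hw => ?_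
        have : z ≠ w := (Finset.ne_of_mem_erase hw).symm
        rw [killedLaplacian, if_neg this, zero_sub, mul_neg, norm_neg, Real.norm_of_nonneg]
        have := hs w
        positivity
    _ ≤ ∑ w : B, reversibleWeight p z * (l * anisotropicStep p z w) := by
        refine Finset.sum_le_sum_of_subset_of_nonneg (Finset.subset_univ _) fun w _ _ => ?_
        have := hs w
        positivity
    _ = reversibleWeight p z * (l * ∑ w : B, anisotropicStep p z w) := by
        rw [← Finset.mul_sum, ← Finset.mul_sum]
    _ ≤ reversibleWeight p z * (l * 1) := by
        gcongr
        exact sum_step_le_one h0 h1 B z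
    _ < reversibleWeight p z := by nlinarith

theorem killedLaplacian_mulVec (l : ℝ) (B : Finset (ℤ × ℤ)) (g : B → ℝ) (z : B) :
    (killedLaplacian p l B).mulVec g z =
      reversibleWeight p z * (g z - l * ∑ w : B, anisotropicStep p z w * g w) := by
  simp only [Matrix.mulVec, dotProduct, killedLaplacian, mul_assoc, ← Finset.mul_sum, sub_mul,
    Finset.sum_sub_distrib]
  simp

/-- At a maximum point with value above `M ≥ 0`, averaging and the discount `l < 1` would make the
Laplacian strictly positive. Only points where `g > M` need checking, so a source at which `g`
equals `M` is harmless. -/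
theorem max_principle (h0 : ∀ j, 0 < p j) (h1 : ∀ j, p j ≤ 1 / 2) {l : ℝ}
    (hl0 : 0 ≤ l) (hl1 : l < 1) {B : Finset (ℤ × ℤ)} (g : B → ℝ) {M : ℝ} (hM : 0 ≤ M)
    (h : ∀ z, M < g z → (killedLaplacian p l B).mulVec g z ≤ 0) (z : B) : g z ≤ M := by
  obtain ⟨z0, -, hz0⟩ := Finset.exists_max_image Finset.univ g ⟨z, Finset.mem_univ z⟩
  refine (hz0 z (Finset.mem_univ z)).trans ?_
  by_contra! hlt
  have hA := h z0 hlt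
  rw [killedLaplacian_mulVec] at hA
  have hm := reversibleWeight_pos h0 (z0 : ℤ × ℤ)
  have hpos : 0 < g z0 := hM.trans_lt hlt
  have hsum : ∑ w : B, anisotropicStep p z0 w * g w ≤ g z0 := by
    calc ∑ w : B, anisotropicStep p z0 w * g w ≤ ∑ w : B, anisotropicStep p z0 w * g z0 :=
          Finset.sum_le_sum fun w _ => mul_le_mul_of_nonneg_left (hz0 w (Finset.mem_univ w))
            (anisotropicStep_nonneg (fun j => (h0 j).le) h1 _ _)
      _ = (∑ w : B, anisotropicStep p z0 w) * g z0 := by rw [Finset.sum_mul]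
      _ ≤ 1 * g z0 := by
          gcongr
          exact sum_step_le_one h0 h1 B z0
      _ = g z0 := one_mul _
  have h3 : 0 < g z0 - l * ∑ w : B, anisotropicStep p z0 w * g w := by nlinarith
  have := mul_pos hm h3
  linarith

/-- The quadratic form dominates `l / 2` times the Dirichlet sum of `c z w * (h z - h w) ^ 2`, since
killing and discounting only add nonnegative diagonal terms. Of that sum the two ordered copies of
the edge `x y` are kept. -/
theorem energy_lower_bound (h0 : ∀ j, 0 < p j) (h1 : ∀ j, p j ≤ 1 / 2) {l : ℝ}
    (hl0 : 0 ≤ l) (hl1 : l < 1) {B : Finset (ℤ × ℤ)} (h : B → ℝ) (x y : B) :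
    l * (reversibleWeight p x * anisotropicStep p x y) * (h y - h x) ^ 2 ≤
      ∑ z, h z * (killedLaplacian p l B).mulVec h z := by
  set c : B → B → ℝ := fun z w => reversibleWeight p z * anisotropicStep p z w with hc
  have hc0 : ∀ z w, 0 ≤ c z w := fun z w => mul_nonneg (reversibleWeight_pos h0 _).le
    (anisotropicStep_nonneg (fun j => (h0 j).le) h1 _ _)
  have hcs : ∀ z w, c z w = c w z := fun z w => reversibleWeight_mul_step_comm h0 _ _
  have hrow : ∀ z, ∑ w, c z w * h z ^ 2 ≤ reversibleWeight p z * h z ^ 2 := by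
    intro z
    rw [← Finset.sum_mul]
    gcongr
    simp only [hc, ← Finset.mul_sum]
    exact mul_le_of_le_one_right (reversibleWeight_pos h0 _).le (sum_step_le_one h0 h1 B z)
  have hsq : ∑ z, ∑ w, c z w * h w ^ 2 = ∑ z, ∑ w, c z w * h z ^ 2 := by
    rw [Finset.sum_comm]
    exact Finset.sum_congr rfl fun z _ => Finset.sum_congr rfl fun w _ => by rw [hcs]
  have hE : ∑ z : B, h z * (killedLaplacian p l B).mulVec h z =
      ∑ z : B, reversibleWeight p z * h z ^ 2 - l * ∑ z, ∑ w, c z w * (h z * h w) := by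
    rw [Finset.mul_sum, ← Finset.sum_sub_distrib]
    refine Finset.sum_congr rfl fun z _ => ?_
    rw [killedLaplacian_mulVec]
    have : ∑ w, c z w * (h z * h w) =
        reversibleWeight p z * h z * ∑ w : B, anisotropicStep p z w * h w := by
      rw [Finset.mul_sum]
      exact Finset.sum_congr rfl fun w _ => by simp only [hc]; ring
    rw [this]; ring
  have hD : l / 2 * ∑ z, ∑ w, c z w * (h z - h w) ^ 2 ≤
      ∑ z, h z * (killedLaplacian p l B).mulVec h z := by
    have h2 : ∑ z, ∑ w, c z w * (h z - h w) ^ 2 = 2 * ∑ z, ∑ w, c z w * h z ^ 2 -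
        2 * ∑ z, ∑ w, c z w * (h z * h w) := by
      have : ∑ z, ∑ w, c z w * (h z - h w) ^ 2 = ∑ z, ∑ w, c z w * h z ^ 2 +
          ∑ z, ∑ w, c z w * h w ^ 2 - 2 * ∑ z, ∑ w, c z w * (h z * h w) := by
        simp only [Finset.mul_sum, ← Finset.sum_add_distrib, ← Finset.sum_sub_distrib]
        exact Finset.sum_congr rfl fun z _ => Finset.sum_congr rfl fun w _ => by ring
      rw [this, hsq]; ring
    rw [hE, h2]
    have h3 : ∑ z, ∑ w, c z w * h z ^ 2 ≤ ∑ z : B, reversibleWeight p z * h z ^ 2 :=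
      Finset.sum_le_sum fun z _ => hrow z
    have h4 : 0 ≤ ∑ z, ∑ w, c z w * h z ^ 2 :=
      Finset.sum_nonneg fun z _ => Finset.sum_nonneg fun w _ => mul_nonneg (hc0 z w) (sq_nonneg _)
    nlinarith
  refine le_trans ?_ hD
  have h5 : 2 * (c x y * (h y - h x) ^ 2) ≤ ∑ z, ∑ w, c z w * (h z - h w) ^ 2 := by
    have hnn : ∀ z w, 0 ≤ c z w * (h z - h w) ^ 2 := fun z w =>
      mul_nonneg (hc0 z w) (sq_nonneg _)
    have hr : ∀ z w, c z w * (h z - h w) ^ 2 ≤ ∑ w, c z w * (h z - h w) ^ 2 := fun z w =>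
      Finset.single_le_sum (f := fun w => c z w * (h z - h w) ^ 2) (fun w _ => hnn z w)
        (Finset.mem_univ w)
    by_cases hxy : x = y
    · subst hxy
      simp only [sub_self, ne_eq, OfNat.ofNat_ne_zero, not_false_eq_true, zero_pow, mul_zero]
      exact Finset.sum_nonneg fun z _ => Finset.sum_nonneg fun w _ => hnn z w
    · calc 2 * (c x y * (h y - h x) ^ 2)
          = c x y * (h x - h y) ^ 2 + c y x * (h y - h x) ^ 2 := by rw [hcs y x]; ring
        _ ≤ ∑ w, c x w * (h x - h w) ^ 2 + ∑ w, c y w * (h y - h w) ^ 2 :=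
            add_le_add (hr x y) (hr y x)
        _ = ∑ z ∈ {x, y}, ∑ w, c z w * (h z - h w) ^ 2 := by rw [Finset.sum_pair hxy]
        _ ≤ _ := Finset.sum_le_sum_of_subset_of_nonneg (Finset.subset_univ _)
            fun z _ _ => Finset.sum_nonneg fun w _ => hnn z w
  have h6 := mul_le_mul_of_nonneg_left h5 (show 0 ≤ l / 2 by positivity)
  simp only [hc] at h6 ⊢
  linarith

/-- The dipole charge density, normalised by the reversible measure. -/
def dipole (p : ℤ → ℝ) (x y z : ℤ × ℤ) : ℝ :=
  ((if z = y then 1 else 0) - (if z = x then 1 else 0)) / reversibleWeight p z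

/-- Take `h = G(·, y) - G(·, x)` with `G` the killed Green function. By the maximum principle `h`
lies between `h x ≤ 0` and `h y ≥ 0`. Its energy is exactly `t = h y - h x`, while the single edge
`x y` contributes at least `l c t²`; hence `t ≤ 1 / (l c) ≤ 2 / c`, independently of `B` and of `l ≥
1/2`. -/
theorem exists_killed_dipole (h0 : ∀ j, 0 < p j) (h1 : ∀ j, p j ≤ 1 / 2) {l : ℝ}
    (hl0 : 1 / 2 ≤ l) (hl1 : l < 1) {B : Finset (ℤ × ℤ)} {x y : ℤ × ℤ} (hx : x ∈ B) (hy : y ∈ B)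
    (hxy : 0 < anisotropicStep p x y) :
    ∃ H : ℤ × ℤ → ℝ, (∀ z, |H z| ≤ 2 / (reversibleWeight p x * anisotropicStep p x y)) ∧
      ∀ z ∈ B, H z - l * stepOp p H z = dipole p x y z := by
  have hl0' : 0 ≤ l := by linarith
  set A := killedLaplacian p l B with hA
  have hdet := killedLaplacian_det_ne_zero h0 h1 hl0' hl1 B
  set G := A⁻¹ with hG
  have hAG : A * G = 1 := Matrix.mul_nonsing_inv _ (isUnit_iff_ne_zero.2 hdet)
  have hGs : ∀ z w, G z w = G w z := by
    intro z w
    have : G.transpose = G := by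
      rw [hG, Matrix.transpose_nonsing_inv, killedLaplacian_transpose h0]
    exact congrFun (congrFun this w) z
  have hcol : ∀ w z, A.mulVec (fun u => G u w) z = if z = w then 1 else 0 := by
    intro w z
    have := congrFun (congrFun hAG z) w
    rw [Matrix.one_apply] at this
    exact this
  have hGnn : ∀ w z, 0 ≤ G z w := by
    intro w z
    have := max_principle h0 h1 hl0' hl1 (fun u => -G u w) le_rfl (fun u _ => ?_) z
    · linarith
    · have h2 : A.mulVec (fun u => -G u w) u = -A.mulVec (fun u => G u w) u := by
        have := congrFun (Matrix.mulVec_neg (fun u => G u w) A) u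
        exact this
      rw [h2, hcol]
      split_ifs <;> norm_num
  have hGmax : ∀ w z, G z w ≤ G w w := by
    intro w z
    refine max_principle h0 h1 hl0' hl1 (fun u => G u w) (hGnn w w) (fun u hu => ?_) z
    have : u ≠ w := by rintro rfl; exact lt_irrefl _ hu
    rw [hcol, if_neg this]
  set x' : B := ⟨x, hx⟩
  set y' : B := ⟨y, hy⟩
  set h : B → ℝ := fun z => G z y' - G z x' with hh
  have hAh : ∀ z, A.mulVec h z = (if z = y' then 1 else 0) - (if z = x' then 1 else 0) := by
    intro z
    have : A.mulVec h z = A.mulVec (fun u => G u y') z - A.mulVec (fun u => G u x') z := by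
      have := congrFun (Matrix.mulVec_sub A (fun u => G u y') (fun u => G u x')) z
      exact this
    rw [this, hcol, hcol]
  have hy0 : 0 ≤ h y' := by
    simp only [hh]
    rw [hGs y' x']
    linarith [hGmax y' x']
  have hx0 : h x' ≤ 0 := by
    simp only [hh]
    rw [hGs x' y']
    linarith [hGmax x' y']
  have hup : ∀ z, h z ≤ h y' := by
    refine max_principle h0 h1 hl0' hl1 h hy0 fun u hu => ?_
    have : u ≠ y' := by rintro rfl; exact lt_irrefl _ hu
    rw [hAh, if_neg this]
    split_ifs <;> norm_num
  have hlo : ∀ z, h x' ≤ h z := by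
    intro z
    have := max_principle h0 h1 hl0' hl1 (fun u => -h u) (M := -h x') (by linarith)
      (fun u hu => ?_) z
    · linarith
    · have hne : u ≠ x' := by rintro rfl; exact lt_irrefl _ hu
      have h2 : A.mulVec (fun u => -h u) u = -A.mulVec h u :=
        congrFun (Matrix.mulVec_neg h A) u
      rw [h2, hAh, if_neg hne]
      split_ifs <;> norm_num
  have hE := energy_lower_bound h0 h1 hl0' hl1 h x' y'
  have hEv : ∑ z, h z * A.mulVec h z = h y' - h x' := by
    simp only [hAh, mul_sub, Finset.sum_sub_distrib]
    simp
  rw [hEv] at hE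
  have hc : 0 < reversibleWeight p x * anisotropicStep p x y :=
    mul_pos (reversibleWeight_pos h0 _) hxy
  have hbound : h y' - h x' ≤ 2 / (reversibleWeight p x * anisotropicStep p x y) := by
    rw [le_div_iff₀ hc]
    set t := h y' - h x'
    have ht : 0 ≤ t := by simp only [t]; linarith
    change l * (reversibleWeight p x * anisotropicStep p x y) * t ^ 2 ≤ t at hE
    set c := reversibleWeight p x * anisotropicStep p x y
    rcases ht.eq_or_lt with h00 | hpos
    · rw [← h00]; norm_num
    · have h3 : l * c * t ≤ 1 := by
        by_contra! hcon
        nlinarith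
      nlinarith [mul_nonneg hc.le ht]
  refine ⟨fun z => if hz : z ∈ B then h ⟨z, hz⟩ else 0, fun z => ?_, fun z hz => ?_⟩
  · by_cases hz : z ∈ B
    · simp only [hz, dif_pos]
      rw [abs_le]
      constructor <;> linarith [hup ⟨z, hz⟩, hlo ⟨z, hz⟩]
    · simp only [hz, dif_neg, not_false_eq_true, abs_zero]
      positivity
  · have h2 := hAh ⟨z, hz⟩
    rw [hA, killedLaplacian_mulVec] at h2
    rw [← sum_step_mul_extend B _ (fun w hw => by simp [hw])]
    simp only [hz, dif_pos]
    have h3 : ∑ w : B, anisotropicStep p z w * (if hw : (w : ℤ × ℤ) ∈ B then h ⟨w, hw⟩ else 0) =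
        ∑ w : B, anisotropicStep p z w * h w :=
      Finset.sum_congr rfl fun w _ => by simp
    rw [h3, dipole, eq_div_iff (reversibleWeight_pos h0 z).ne', mul_comm, h2]
    simp [x', y', Subtype.ext_iff]

theorem exists_bounded_dipole (h0 : ∀ j, 0 < p j) (h1 : ∀ j, p j ≤ 1 / 2) {x y : ℤ × ℤ}
    (hxy : 0 < anisotropicStep p x y) :
    ∃ (H : ℤ × ℤ → ℝ) (K : ℝ), (∀ z, |H z| ≤ K) ∧ ∀ z, H z - stepOp p H z = dipole p x y z := by
  set K := 2 / (reversibleWeight p x * anisotropicStep p x y) with hK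
  set l : ℕ → ℝ := fun n => 1 - 1 / ((n : ℝ) + 2) with hl
  have hl0 : ∀ n, 1 / 2 ≤ l n := by
    intro n
    have : 1 / ((n : ℝ) + 2) ≤ 1 / 2 :=
      one_div_le_one_div_of_le (by norm_num) (by linarith [n.cast_nonneg (α := ℝ)])
    simp only [hl]; linarith
  have hl1 : ∀ n, l n < 1 := by
    intro n
    have : 0 < 1 / ((n : ℝ) + 2) := by positivity
    simp only [hl]; linarith
  have hlt : Tendsto l atTop (𝓝 1) := by
    have h2 : Tendsto (fun n : ℕ => 1 / ((n : ℝ) + 2)) atTop (𝓝 0) := by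
      have := (tendsto_one_div_add_atTop_nhds_zero_nat (𝕜 := ℝ)).comp (tendsto_add_atTop_nat 1)
      refine this.congr fun n => ?_
      simp only [Function.comp]
      push_cast
      ring_nf
    simpa [hl] using (tendsto_const_nhds (x := (1 : ℝ))).sub h2
  set B : ℕ → Finset (ℤ × ℤ) := fun n => insert x (insert y (Finset.Icc (-n, -n) (n, n)))
  have hex : ∀ n, ∃ H : ℤ × ℤ → ℝ, (∀ z, |H z| ≤ K) ∧
      ∀ z ∈ B n, H z - l n * stepOp p H z = dipole p x y z := fun n =>
    exists_killed_dipole h0 h1 (hl0 n) (hl1 n) (by simp [B]) (by simp [B]) hxy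
  choose H hHK hH using hex
  -- A fixed ultrafilter provides limits at all points simultaneously, with no diagonal extraction;
  -- the equation survives because `stepOp` is a finite sum.
  have hlim : ∀ z, ∃ a ∈ Set.Icc (-K) K, Tendsto (fun n => H n z) (hyperfilter ℕ) (𝓝 a) := by
    intro z
    obtain ⟨a, ha, hle⟩ := (isCompact_Icc (a := -K) (b := K)).ultrafilter_le_nhds
      ((hyperfilter ℕ).map fun n => H n z) (by
        rw [Ultrafilter.coe_map, le_principal_iff]
        exact Filter.mem_map.2 (Filter.univ_mem' fun n => abs_le.1 (hHK n z)))
    exact ⟨a, ha, hle⟩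
  choose h hh hht using hlim
  refine ⟨h, K, fun z => abs_le.2 (hh z), fun z => ?_⟩
  have hle : (hyperfilter ℕ : Filter ℕ) ≤ atTop := Nat.hyperfilter_le_atTop
  have ht1 : Tendsto (fun n => H n z - l n * stepOp p (H n) z) (hyperfilter ℕ)
      (𝓝 (h z - 1 * stepOp p h z)) := by
    refine (hht z).sub ((hlt.mono_left hle).mul ?_)
    exact tendsto_finsetSum _ fun w _ => tendsto_const_nhds.mul (hht w)
  have ht2 : Tendsto (fun n => H n z - l n * stepOp p (H n) z) (hyperfilter ℕ)
      (𝓝 (dipole p x y z)) := by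
    refine tendsto_const_nhds.congr' ?_
    refine hle (eventually_atTop.2 ⟨z.1.natAbs + z.2.natAbs, fun n hn => ?_⟩)
    refine (hH n z ?_).symm
    simp only [B, Finset.mem_insert, Finset.mem_Icc, Prod.le_def]
    right; right
    refine ⟨⟨?_, ?_⟩, ?_, ?_⟩ <;> omega
  have := tendsto_nhds_unique ht1 ht2
  rwa [one_mul] at this

end Dipole
end

/-! ### Lyapunov function of the half-plane half-comb walk -/

noncomputable section

/-- The radial profile `log s - 4 / s + 4` of the Lyapunov function. -/
def logProfile (s : ℝ) : ℝ := Real.log s - 4 / s + 4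

theorem log_le_logProfile {s : ℝ} (hs : 1 ≤ s) : Real.log s ≤ logProfile s := by
  have : 4 / s ≤ 4 := div_le_self (by norm_num) hs
  unfold logProfile; linarith

theorem logProfile_nonneg {s : ℝ} (hs : 1 ≤ s) : 0 ≤ logProfile s :=
  (Real.log_nonneg hs).trans (log_le_logProfile hs)

theorem inv_lower_taylor {S d : ℝ} (hS : 0 < S) (hd : 0 < S + d) :
    1 / S - d / S ^ 2 + d ^ 2 / S ^ 3 - d ^ 3 / S ^ 4 ≤ 1 / (S + d) := by
  have : 1 / (S + d) - (1 / S - d / S ^ 2 + d ^ 2 / S ^ 3 - d ^ 3 / S ^ 4) =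
      d ^ 4 / (S ^ 4 * (S + d)) := by
    field_simp
    ring
  have h2 : 0 ≤ d ^ 4 / (S ^ 4 * (S + d)) := by positivity
  linarith

/-- The four logarithms can exceed `4 log S` by about `32 / S²`, whereas the correction `-4 / s`
gains about `64 / S²`. The remaining surplus leaves room for the extra `1 / S²`, which pays for
entering the comb. -/
theorem logProfile_superharmonic {X Y : ℝ} (h : 100 ≤ X ^ 2 + Y ^ 2) :
    logProfile ((X + 2) ^ 2 + Y ^ 2) + logProfile ((X - 2) ^ 2 + Y ^ 2) +
      logProfile (X ^ 2 + (Y + 2) ^ 2) + logProfile (X ^ 2 + (Y - 2) ^ 2) +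
      1 / (X ^ 2 + Y ^ 2) ^ 2 ≤ 4 * logProfile (X ^ 2 + Y ^ 2) := by
  set S := X ^ 2 + Y ^ 2 with hS
  have hS0 : 0 < S := by linarith
  have e1 : (X + 2) ^ 2 + Y ^ 2 = S + (4 + 4 * X) := by rw [hS]; ring
  have e2 : (X - 2) ^ 2 + Y ^ 2 = S + (4 - 4 * X) := by rw [hS]; ring
  have e3 : X ^ 2 + (Y + 2) ^ 2 = S + (4 + 4 * Y) := by rw [hS]; ring
  have e4 : X ^ 2 + (Y - 2) ^ 2 = S + (4 - 4 * Y) := by rw [hS]; ring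
  have p1 : 0 < S + (4 + 4 * X) := by nlinarith [sq_nonneg (X + 4), sq_nonneg Y]
  have p2 : 0 < S + (4 - 4 * X) := by nlinarith [sq_nonneg (X - 4), sq_nonneg Y]
  have p3 : 0 < S + (4 + 4 * Y) := by nlinarith [sq_nonneg (Y + 4), sq_nonneg X]
  have p4 : 0 < S + (4 - 4 * Y) := by nlinarith [sq_nonneg (Y - 4), sq_nonneg X]
  rw [e1, e2, e3, e4]
  have hlog : Real.log (S + (4 + 4 * X)) + Real.log (S + (4 - 4 * X)) +
      Real.log (S + (4 + 4 * Y)) + Real.log (S + (4 - 4 * Y)) ≤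
      4 * Real.log S + (32 / S ^ 2 + 256 / S ^ 4) := by
    -- The sum of logarithms is bounded through the product: `log t ≤ t - 1` applied to `Q / S ^ 4`,
    -- with `4 X² Y² ≤ S²`.
    set Q := (S + (4 + 4 * X)) * (S + (4 - 4 * X)) * (S + (4 + 4 * Y)) * (S + (4 - 4 * Y)) with hQ
    have hQ0 : 0 < Q := by positivity
    have h1 : Real.log (S + (4 + 4 * X)) + Real.log (S + (4 - 4 * X)) +
        Real.log (S + (4 + 4 * Y)) + Real.log (S + (4 - 4 * Y)) = Real.log Q := by
      rw [hQ, Real.log_mul (by positivity) p4.ne', Real.log_mul (by positivity) p3.ne',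
        Real.log_mul p1.ne' p2.ne']
    have h2 : Real.log Q = 4 * Real.log S + Real.log (Q / S ^ 4) := by
      rw [Real.log_div hQ0.ne' (by positivity), Real.log_pow]
      push_cast; ring
    have h3 := Real.log_le_sub_one_of_pos (show 0 < Q / S ^ 4 by positivity)
    have h4 : Q ≤ S ^ 4 + 32 * S ^ 2 + 256 := by
      have hQe : Q = S ^ 4 - 32 * S ^ 2 + 256 * (X ^ 2 * Y ^ 2) + 256 := by
        rw [hQ, hS]; ring
      have : 4 * (X ^ 2 * Y ^ 2) ≤ S ^ 2 := by
        rw [hS]; nlinarith [sq_nonneg (X ^ 2 - Y ^ 2)]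
      linarith
    have h5 : Q / S ^ 4 ≤ 1 + (32 / S ^ 2 + 256 / S ^ 4) := by
      rw [div_le_iff₀ (by positivity)]
      have : (1 + (32 / S ^ 2 + 256 / S ^ 4)) * S ^ 4 = S ^ 4 + 32 * S ^ 2 + 256 := by
        field_simp
        ring
      linarith
    linarith
  have hinv : 4 / S + 16 / S ^ 2 - 320 / S ^ 3 - 256 / S ^ 4 ≤ 1 / (S + (4 + 4 * X)) +
      1 / (S + (4 - 4 * X)) + 1 / (S + (4 + 4 * Y)) + 1 / (S + (4 - 4 * Y)) := by
    have t1 := inv_lower_taylor hS0 p1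
    have t2 := inv_lower_taylor hS0 p2
    have t3 := inv_lower_taylor hS0 p3
    have t4 := inv_lower_taylor hS0 p4
    have hd2 : (4 + 4 * X) ^ 2 + (4 - 4 * X) ^ 2 + (4 + 4 * Y) ^ 2 + (4 - 4 * Y) ^ 2 =
        64 + 32 * S := by rw [hS]; ring
    have hd3 : (4 + 4 * X) ^ 3 + (4 - 4 * X) ^ 3 + (4 + 4 * Y) ^ 3 + (4 - 4 * Y) ^ 3 =
        256 + 384 * S := by rw [hS]; ring
    have e : 4 / S + 16 / S ^ 2 - 320 / S ^ 3 - 256 / S ^ 4 =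
        4 / S - 16 / S ^ 2 + (64 + 32 * S) / S ^ 3 - (256 + 384 * S) / S ^ 4 := by
      field_simp; ring
    rw [e, ← hd2, ← hd3]
    have := add_le_add (add_le_add t1 t2) (add_le_add t3 t4)
    refine le_trans (le_of_eq ?_) (this.trans (le_of_eq ?_)) <;> ring
  have hfin : 1 / S ^ 2 + 1280 / S ^ 3 + 1280 / S ^ 4 ≤ 32 / S ^ 2 := by
    have e : 32 / S ^ 2 - (1 / S ^ 2 + 1280 / S ^ 3 + 1280 / S ^ 4) =
        (31 * S ^ 2 - 1280 * S - 1280) / S ^ 4 := by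
      field_simp; ring
    have : 0 ≤ (31 * S ^ 2 - 1280 * S - 1280) / S ^ 4 := by
      apply div_nonneg _ (by positivity)
      nlinarith
    linarith
  unfold logProfile
  have r1 : ∀ t : ℝ, 4 / t = 4 * (1 / t) := fun t => by ring
  have r2 : 32 / S ^ 2 = 2 * (16 / S ^ 2) := by ring
  have r3 : 1280 / S ^ 3 = 4 * (320 / S ^ 3) := by ring
  have r4 : 1280 / S ^ 4 = 4 * (256 / S ^ 4) + 256 / S ^ 4 := by ring
  rw [r1 (S + _), r1 (S + _), r1 (S + _), r1 (S + _)]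
  linarith

/-- Lyapunov function of the half-plane half-comb walk. -/
def hphcLyapunov (z : ℤ × ℤ) : ℝ :=
  if 0 ≤ z.2 then logProfile ((2 * z.1) ^ 2 + (2 * z.2 + 1) ^ 2)
  else logProfile ((2 * z.1) ^ 2 + 1) + (-z.2) * (1 / ((2 * z.1) ^ 2 + 1) ^ 2)

theorem hphcLyapunov_nonneg (z : ℤ × ℤ) : 0 ≤ hphcLyapunov z := by
  unfold hphcLyapunov
  split_ifs with h
  · apply logProfile_nonneg
    have : (0 : ℝ) ≤ z.2 := by exact_mod_cast h
    nlinarith [sq_nonneg (2 * (z.1 : ℝ))]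
  · have h1 : (0 : ℝ) ≤ -z.2 := by
      have : z.2 ≤ 0 := by omega
      have : (z.2 : ℝ) ≤ 0 := by exact_mod_cast this
      linarith
    have := logProfile_nonneg (s := (2 * (z.1 : ℝ)) ^ 2 + 1) (by nlinarith [sq_nonneg (z.1 : ℝ)])
    positivity

/-- The finite set off which `hphcLyapunov` is superharmonic. -/
def hphcCore : Finset (ℤ × ℤ) := Finset.Icc (-10, -10) (10, 10)

/-- On the comb only vertical moves occur and the function is affine in `j`, so equality holds.
Above, centring at height `-1/2` gives rows `0` and `-1` the same radial term, so the only
discrepancy is the comb slope at `j = 0`, absorbed by the surplus of `logProfile_superharmonic`. -/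
theorem stepOp_hphcLyapunov_le {z : ℤ × ℤ} (hz : z ∉ hphcCore) :
    stepOp hphcParam hphcLyapunov z ≤ hphcLyapunov z := by
  obtain ⟨k, j⟩ := z
  rw [stepOp_eq]
  by_cases hj : 0 ≤ j
  · have hbig : (100 : ℝ) ≤ (2 * k : ℝ) ^ 2 + (2 * j + 1) ^ 2 := by
      have : 100 ≤ (2 * k) ^ 2 + (2 * j + 1) ^ 2 := by
        simp only [hphcCore, Finset.mem_Icc, Prod.mk_le_mk] at hz
        by_cases hj10 : j ≤ 10
        · have : k < -10 ∨ 10 < k := by omega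
          rcases this with h | h <;> nlinarith [sq_nonneg (2 * j + 1)]
        · nlinarith [sq_nonneg (2 * k)]
      exact_mod_cast this
    have hmain := logProfile_superharmonic hbig
    have hj1 : 0 ≤ j + 1 := by omega
    have a1 : hphcLyapunov (k + 1, j) = logProfile ((2 * k + 2) ^ 2 + (2 * j + 1) ^ 2) := by
      simp only [hphcLyapunov, hj, if_true]; push_cast; ring_nf
    have a2 : hphcLyapunov (k - 1, j) = logProfile ((2 * k - 2) ^ 2 + (2 * j + 1) ^ 2) := by
      simp only [hphcLyapunov, hj, if_true]; push_cast; ring_nf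
    have a3 : hphcLyapunov (k, j + 1) = logProfile ((2 * k) ^ 2 + (2 * j + 1 + 2) ^ 2) := by
      simp only [hphcLyapunov, hj1, if_true]; push_cast; ring_nf
    have a0 : hphcLyapunov (k, j) = logProfile ((2 * k) ^ 2 + (2 * j + 1) ^ 2) := by
      simp only [hphcLyapunov, hj, if_true]
    have a4 : hphcLyapunov (k, j - 1) ≤ logProfile ((2 * k) ^ 2 + (2 * j + 1 - 2) ^ 2) +
        1 / ((2 * (k : ℝ)) ^ 2 + (2 * j + 1) ^ 2) ^ 2 := by
      by_cases h0 : j = 0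
      · subst h0
        simp only [hphcLyapunov]
        norm_num
      · have hj2 : 0 ≤ j - 1 := by omega
        simp only [hphcLyapunov, hj2, if_true]
        have : (0 : ℝ) ≤ 1 / ((2 * (k : ℝ)) ^ 2 + (2 * j + 1) ^ 2) ^ 2 := by positivity
        refine le_trans (le_of_eq ?_) (le_add_of_nonneg_right this)
        push_cast; ring_nf
    simp only [hphcParam, hj, if_true, a1, a2, a3, a0]
    linarith
  · have a0 : ∀ i : ℤ, i ≤ 0 → hphcLyapunov (k, i) = logProfile ((2 * k) ^ 2 + 1) +
        (-i) * (1 / ((2 * (k : ℝ)) ^ 2 + 1) ^ 2) := by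
      intro i hi
      rcases hi.eq_or_lt with rfl | hlt
      · simp [hphcLyapunov]
      · simp only [hphcLyapunov, hlt.not_ge, if_false]
    simp only [hphcParam, hj, if_false]
    rw [a0 j (by omega), a0 (j + 1) (by omega), a0 (j - 1) (by omega)]
    push_cast
    apply le_of_eq
    ring

theorem finite_hphcLyapunov_le (M : ℝ) : {z | hphcLyapunov z ≤ M}.Finite := by
  -- The logarithm forces `s ≤ exp M`; on a tooth, the linear term then forces `-j ≤ M s² ≤ |M| (exp
  -- M)²`.
  obtain ⟨N, hN⟩ := exists_nat_ge (Real.exp M + |M| * Real.exp M ^ 2)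
  refine (Set.finite_Icc ((-N, -N) : ℤ × ℤ) (N, N)).subset ?_
  rintro ⟨k, j⟩ hz
  change hphcLyapunov (k, j) ≤ M at hz
  have hk2 : (|k| : ℝ) ≤ (2 * k : ℝ) ^ 2 := by
    have : |k| ≤ (2 * k) ^ 2 := by
      rcases abs_cases k with ⟨h, _⟩ | ⟨h, _⟩ <;> rw [h] <;> nlinarith
    exact_mod_cast this
  have hpos : 0 ≤ |M| * Real.exp M ^ 2 := by positivity
  have hexp := Real.exp_pos M
  have key : (|k| : ℝ) ≤ N ∧ (|j| : ℝ) ≤ N := by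
    by_cases hj : 0 ≤ j
    · simp only [hphcLyapunov, hj, if_true] at hz
      have hj' : (0 : ℝ) ≤ j := by exact_mod_cast hj
      have hs : (1 : ℝ) ≤ (2 * k) ^ 2 + (2 * j + 1) ^ 2 := by nlinarith [sq_nonneg (2 * (k : ℝ))]
      have hs2 := (Real.log_le_iff_le_exp (by linarith)).1 ((log_le_logProfile hs).trans hz)
      rw [abs_of_nonneg hj']
      constructor <;> nlinarith [sq_nonneg (2 * (k : ℝ))]
    · simp only [hphcLyapunov, hj, if_false] at hz
      have hj' : (j : ℝ) < 0 := by exact_mod_cast not_le.1 hj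
      have hs : (1 : ℝ) ≤ (2 * k) ^ 2 + 1 := by nlinarith [sq_nonneg (2 * (k : ℝ))]
      set s : ℝ := (2 * k) ^ 2 + 1 with hsdef
      have hl := log_le_logProfile hs
      have hl0 := logProfile_nonneg hs
      have hp : 0 ≤ -(j : ℝ) * (1 / s ^ 2) := by
        have : 0 ≤ -(j : ℝ) := by linarith
        positivity
      have hs2 := (Real.log_le_iff_le_exp (by linarith)).1 (show Real.log s ≤ M by linarith)
      have h3 : -(j : ℝ) * (1 / s ^ 2) ≤ M := by linarith
      rw [mul_one_div, div_le_iff₀ (by positivity)] at h3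
      rw [abs_of_neg hj']
      refine ⟨by linarith, ?_⟩
      have : M * s ^ 2 ≤ |M| * Real.exp M ^ 2 := by
        gcongr
        exact le_abs_self M
      linarith
  have hk : |k| ≤ N := by exact_mod_cast key.1
  have hj : |j| ≤ N := by exact_mod_cast key.2
  rw [abs_le] at hk hj
  simp only [Set.mem_Icc, Prod.mk_le_mk]
  exact ⟨⟨hk.1, hj.1⟩, hk.2, hj.2⟩

end

/-! ### Bounded measurable functions and recurrence -/

noncomputable section

section BddMeasurable

variable {Ω : Type*}

/-- Bounded functions measurable for a given `σ`-algebra. -/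
def IsBddMeasurable (m : MeasurableSpace Ω) (f : Ω → ℝ) : Prop :=
  Measurable[m] f ∧ ∃ K, ∀ ω, |f ω| ≤ K

namespace IsBddMeasurable

variable {m m' : MeasurableSpace Ω} {f g : Ω → ℝ}

theorem mono (hf : IsBddMeasurable m f) (h : m ≤ m') : IsBddMeasurable m' f :=
  ⟨hf.1.mono h le_rfl, hf.2⟩

theorem add (hf : IsBddMeasurable m f) (hg : IsBddMeasurable m g) :
    IsBddMeasurable m (fun ω => f ω + g ω) := by
  obtain ⟨hf1, K, hK⟩ := hf
  obtain ⟨hg1, M, hM⟩ := hg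
  exact ⟨hf1.add hg1, K + M, fun ω => (abs_add_le _ _).trans (add_le_add (hK ω) (hM ω))⟩

theorem mul (hf : IsBddMeasurable m f) (hg : IsBddMeasurable m g) :
    IsBddMeasurable m (fun ω => f ω * g ω) := by
  obtain ⟨hf1, K, hK⟩ := hf
  obtain ⟨hg1, M, hM⟩ := hg
  refine ⟨hf1.mul hg1, K * M, fun ω => ?_⟩
  rw [abs_mul]
  exact mul_le_mul (hK ω) (hM ω) (abs_nonneg _) ((abs_nonneg _).trans (hK ω))

theorem const (c : ℝ) : IsBddMeasurable m (fun _ => c) :=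
  ⟨measurable_const, |c|, fun _ => le_rfl⟩

theorem sub (hf : IsBddMeasurable m f) (hg : IsBddMeasurable m g) :
    IsBddMeasurable m (fun ω => f ω - g ω) := by
  simpa [sub_eq_add_neg] using hf.add ((const (-1)).mul hg)

theorem sq (hf : IsBddMeasurable m f) : IsBddMeasurable m (fun ω => f ω ^ 2) := by
  simpa [pow_two] using hf.mul hf

theorem sum {ι : Type*} (s : Finset ι) {F : ι → Ω → ℝ} (hF : ∀ i ∈ s, IsBddMeasurable m (F i)) :
    IsBddMeasurable m (fun ω => ∑ i ∈ s, F i ω) := by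
  classical
  induction s using Finset.induction_on with
  | empty => simpa using const 0
  | insert a s ha ih =>
    simp only [Finset.sum_insert ha]
    exact (hF a (Finset.mem_insert_self a s)).add
      (ih fun i hi => hF i (Finset.mem_insert_of_mem hi))

theorem comp {X : Ω → ℤ × ℤ} (hX : Measurable[m] X) {F : ℤ × ℤ → ℝ} {K : ℝ}
    (hF : ∀ z, |F z| ≤ K) : IsBddMeasurable m (fun ω => F (X ω)) :=
  ⟨(measurable_of_countable F).comp hX, K, fun _ => hF _⟩

theorem integrable [MeasurableSpace Ω] {P : Measure Ω} [IsProbabilityMeasure P]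
    (hf : IsBddMeasurable inferInstance f) : Integrable f P :=
  let ⟨h, K, hK⟩ := hf
  Integrable.of_bound h.aestronglyMeasurable K (Eventually.of_forall hK)

end IsBddMeasurable
end BddMeasurable

section Recurrence

variable {Ω : Type*} [MeasurableSpace Ω] {P : Measure Ω} [IsProbabilityMeasure P]
  {p : ℤ → ℝ} {C : ℕ → Ω → ℤ × ℤ}

-- Until the walk hits `F`, `u (C N)` is a supermartingale, so its mean over paths avoiding `F`
-- during `[n, N)` never exceeds the mean at time `n`. On `D` the path avoids `F` and leaves every
-- finite set, so `u (C N)` tends to 1 there.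
open Classical in
theorem IsAnisotropicWalk.measureReal_escape_le (hC : IsAnisotropicWalk P p C)
    (h0 : ∀ j, 0 ≤ p j) (h1 : ∀ j, p j ≤ 1 / 2) {u : ℤ × ℤ → ℝ} {F : Finset (ℤ × ℤ)}
    (hu0 : ∀ z, 0 ≤ u z) (hu1 : ∀ z, u z ≤ 1) (hu : ∀ z ∉ F, stepOp p u z ≤ u z)
    (hfin : ∀ᶠ z in cofinite, u z = 1) (n : ℕ) {D : Set Ω} (hD : MeasurableSet D)
    (hDF : ∀ ω ∈ D, ∀ r ≥ n, C r ω ∉ F) (hDt : ∀ ω ∈ D, Tendsto (fun r => C r ω) atTop cofinite) :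
    P.real D ≤ ∫ ω, u (C n ω) ∂P := by
  have hub : ∀ z, |u z| ≤ 1 := fun z => abs_le.2 ⟨by linarith [hu0 z], hu1 z⟩
  set g : ℕ → Ω → ℝ := fun N ω => ∏ r ∈ Finset.Ico n N, if C r ω ∈ F then 0 else 1 with hg
  have hg01 : ∀ N ω, 0 ≤ g N ω ∧ g N ω ≤ 1 := by
    intro N ω
    constructor
    · exact Finset.prod_nonneg fun r _ => by split_ifs <;> norm_num
    · exact Finset.prod_le_one (fun r _ => by split_ifs <;> norm_num)
        (fun r _ => by split_ifs <;> norm_num)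
  have hgb : ∀ N ω, |g N ω| ≤ 1 := fun N ω =>
    abs_le.2 ⟨by linarith [(hg01 N ω).1], (hg01 N ω).2⟩
  have hgm : ∀ N, Measurable[historyFiltration C hC.measurable N] (g (N + 1)) := by
    intro N
    refine Finset.measurable_prod _ fun r hr => ?_
    have hr' : r ≤ N := by
      have := (Finset.mem_Ico.1 hr).2
      omega
    exact (measurable_of_countable (fun z : ℤ × ℤ => if z ∈ F then (0 : ℝ) else 1)).comp
      (measurable_historyFiltration hC.measurable hr')
  have hgm' : ∀ N, Measurable (g N) := by
    intro N
    refine Finset.measurable_prod _ fun r hr => ?_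
    exact (measurable_of_countable (fun z : ℤ × ℤ => if z ∈ F then (0 : ℝ) else 1)).comp
      (hC.measurable r)
  have hub' : ∀ N, IsBddMeasurable inferInstance (fun ω => u (C N ω)) := fun N =>
    IsBddMeasurable.comp (hC.measurable N) hub
  have hgB : ∀ N, IsBddMeasurable inferInstance (g N) := fun N => ⟨hgm' N, 1, hgb N⟩
  have hstep : ∀ N ≥ n, ∫ ω, g N ω * u (C N ω) ∂P ≤ ∫ ω, u (C n ω) ∂P := by
    intro N hN
    induction N, hN using Nat.le_induction with
    | base => simp [hg]
    | succ N hN ih =>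
      rw [hC.integral_mul_comp h0 h1 hub (hgm N) (hgb (N + 1))]
      refine le_trans ?_ ih
      refine integral_mono ?_ ((hgB N).mul (hub' N)).integrable fun ω => ?_
      · exact ((hgB (N + 1)).mul
          (IsBddMeasurable.comp (hC.measurable N) (abs_stepOp_le h0 h1 hub))).integrable
      · have hs : g (N + 1) ω = g N ω * if C N ω ∈ F then 0 else 1 := by
          simp only [hg]
          rw [Finset.prod_Ico_succ_top hN]
        simp only [hs]
        by_cases hF : C N ω ∈ F
        · simp only [hF, if_true, mul_zero, zero_mul]
          exact mul_nonneg (hg01 N ω).1 (hu0 _)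
        · simp only [hF, if_false, mul_one]
          exact mul_le_mul_of_nonneg_left (hu _ hF) (hg01 N ω).1
  have hlim : Tendsto (fun N => ∫ ω, D.indicator (fun ω => u (C N ω)) ω ∂P) atTop
      (𝓝 (∫ ω, D.indicator (fun _ => (1 : ℝ)) ω ∂P)) := by
    refine tendsto_integral_of_dominated_convergence (fun _ => 1) (fun N => ?_)
      (integrable_const 1) (fun N => Eventually.of_forall fun ω => ?_)
      (Eventually.of_forall fun ω => ?_)
    · exact ((hub' N).1.indicator hD).aestronglyMeasurable
    · by_cases h : ω ∈ D
      · simpa [h] using hub (C N ω)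
      · simp [h]
    · by_cases h : ω ∈ D
      · simp only [h, Set.indicator_of_mem]
        refine tendsto_const_nhds.congr' ?_
        filter_upwards [(hDt ω h).eventually hfin] with N hN
        exact hN.symm
      · simp only [h, Set.indicator_of_notMem, not_false_eq_true]
        exact tendsto_const_nhds
  rw [integral_indicator_const _ hD, smul_eq_mul, mul_one] at hlim
  refine le_of_tendsto hlim ?_
  filter_upwards [eventually_ge_atTop n] with N hN
  refine le_trans (integral_mono ((hub' N).integrable.indicator hD)
    ((hgB N).mul (hub' N)).integrable fun ω => ?_) (hstep N hN)
  by_cases h : ω ∈ D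
  · have : g N ω = 1 := by
      simp only [hg]
      refine Finset.prod_eq_one fun r hr => ?_
      rw [if_neg (hDF ω h r (Finset.mem_Ico.1 hr).1)]
    simp [h, this]
  · simp only [h, Set.indicator_of_notMem, not_false_eq_true]
    exact mul_nonneg (hg01 N ω).1 (hu0 _)

/-- The escape bound with `u = min (V / (R + 1)) 1` tends to 0 as `R → ∞`. A path visiting each
point finitely often eventually avoids the finite set `F`, so it lies in one of the null events `D
n`. -/
theorem IsAnisotropicWalk.ae_exists_frequently_visited (hC : IsAnisotropicWalk P p C)
    (h0 : ∀ j, 0 ≤ p j) (h1 : ∀ j, p j ≤ 1 / 2) {V : ℤ × ℤ → ℝ} {F : Finset (ℤ × ℤ)}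
    (hV0 : ∀ z, 0 ≤ V z) (hV : ∀ z ∉ F, stepOp p V z ≤ V z)
    (hfin : ∀ M : ℝ, {z | V z ≤ M}.Finite) :
    ∀ᵐ ω ∂P, ∃ z, ∃ᶠ n in atTop, C n ω = z := by
  set D : ℕ → Set Ω := fun n => (⋂ r, ⋂ (_ : n ≤ r), (C r ⁻¹' (F : Set (ℤ × ℤ)))ᶜ) ∩
    ⋂ z, ⋃ m, ⋂ r, ⋂ (_ : m ≤ r), (C r ⁻¹' {z})ᶜ with hDdef
  have hDmem : ∀ n ω, ω ∈ D n ↔ (∀ r ≥ n, C r ω ∉ F) ∧ ∀ z, ∃ m, ∀ r ≥ m, C r ω ≠ z := by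
    intro n ω
    simp [hDdef]
  have hDm : ∀ n, MeasurableSet (D n) := by
    intro n
    refine MeasurableSet.inter ?_ ?_
    · exact MeasurableSet.iInter fun r => MeasurableSet.iInter fun _ =>
        (hC.measurable r F.measurableSet).compl
    · exact MeasurableSet.iInter fun z => MeasurableSet.iUnion fun m => MeasurableSet.iInter fun r =>
        MeasurableSet.iInter fun _ => (hC.measurable r (measurableSet_singleton z)).compl
  have hDt : ∀ n, ∀ ω ∈ D n, Tendsto (fun r => C r ω) atTop cofinite := by
    intro n ω hω s hs
    have : ∀ᶠ r in atTop, ∀ z ∈ sᶜ, C r ω ≠ z := (Filter.eventually_all_finite hs).2 fun z _ =>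
      eventually_atTop.2 (((hDmem n ω).1 hω).2 z)
    refine this.mono fun r hr => ?_
    by_contra hcon
    exact hr _ hcon rfl
  have hD0 : ∀ n, P (D n) = 0 := by
    intro n
    have hle : ∀ R : ℕ, P.real (D n) ≤ ∫ ω, min (V (C n ω) / (R + 1 : ℝ)) 1 ∂P := by
      intro R
      have hR : (0 : ℝ) < R + 1 := by positivity
      refine hC.measureReal_escape_le h0 h1 (u := fun z => min (V z / (R + 1 : ℝ)) 1) (F := F)
        (fun z => le_min (div_nonneg (hV0 z) hR.le) zero_le_one) (fun z => min_le_right _ _)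
        (fun z hz => ?_) ?_ n (hDm n) (fun ω hω => ((hDmem n ω).1 hω).1) (hDt n)
      · refine le_min ?_ ?_
        · calc stepOp p (fun z => min (V z / (R + 1 : ℝ)) 1) z
              ≤ stepOp p (fun z => V z / (R + 1 : ℝ)) z :=
                stepOp_mono h0 h1 (fun z => min_le_left _ _) z
            _ = stepOp p V z / (R + 1 : ℝ) := by
                simp only [stepOp, Finset.sum_div, mul_div_assoc]
            _ ≤ V z / (R + 1 : ℝ) := by
                gcongr
                exact hV z hz
        · exact (stepOp_mono h0 h1 (fun z => min_le_right _ _) z).trans_eq (stepOp_const p 1 z)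
      · refine (hfin (R + 1)).subset fun z hz => ?_
        by_contra hcon
        refine hz (min_eq_right ?_)
        rw [le_div_iff₀ hR, one_mul]
        exact (not_le.1 hcon).le
    have hlim : Tendsto (fun R : ℕ => ∫ ω, min (V (C n ω) / (R + 1 : ℝ)) 1 ∂P) atTop
        (𝓝 (∫ _, (0 : ℝ) ∂P)) := by
      refine tendsto_integral_of_dominated_convergence (fun _ => 1) (fun R => ?_)
        (integrable_const 1) (fun R => Eventually.of_forall fun ω => ?_)
        (Eventually.of_forall fun ω => ?_)
      · exact ((measurable_of_countable fun z => min (V z / (R + 1 : ℝ)) 1).comp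
          (hC.measurable n)).aestronglyMeasurable
      · have : 0 ≤ min (V (C n ω) / (R + 1 : ℝ)) 1 :=
          le_min (div_nonneg (hV0 _) (by positivity)) zero_le_one
        rw [Real.norm_of_nonneg this]
        exact min_le_right _ _
      · have h2 : Tendsto (fun R : ℕ => V (C n ω) / (R + 1 : ℝ)) atTop (𝓝 0) := by
          have := (tendsto_one_div_add_atTop_nhds_zero_nat (𝕜 := ℝ)).const_mul (V (C n ω))
          simpa [mul_one_div, ← div_eq_mul_inv] using this
        have := h2.min (tendsto_const_nhds (x := (1 : ℝ)))
        simpa using this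
    have h3 : P.real (D n) ≤ 0 := by
      have := ge_of_tendsto' hlim hle
      simpa using this
    have h4 : P.real (D n) = 0 := le_antisymm h3 measureReal_nonneg
    exact (measureReal_eq_zero_iff).1 h4
  have hae : ∀ᵐ ω ∂P, ∀ n, ω ∉ D n := ae_all_iff.2 fun n => measure_eq_zero_iff_ae_notMem.1 (hD0 n)
  filter_upwards [hae] with ω hω
  by_contra! hcon
  have hz : ∀ z, ∀ᶠ r in atTop, C r ω ≠ z := fun z => by simpa using hcon z
  have hF : ∀ᶠ r in atTop, C r ω ∉ F := by
    have : ∀ᶠ r in atTop, ∀ z ∈ F, C r ω ≠ z := (Filter.eventually_all_finset F).2 fun z _ => hz z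
    filter_upwards [this] with r hr hmem
    exact hr _ hmem rfl
  obtain ⟨n, hn⟩ := eventually_atTop.1 hF
  exact hω n ((hDmem n ω).2 ⟨hn, fun z => eventually_atTop.1 (hz z)⟩)

end Recurrence
end

/-! ### Kronecker's lemma, visit counts and discount weights -/

noncomputable section

section Deterministic

/-- **Kronecker's lemma**. -/
theorem kronecker_isLittleO {a d : ℕ → ℝ} (ha0 : ∀ n, 0 < a n) (ham : Monotone a)
    (ha : Tendsto a atTop atTop) {s : ℝ}
    (hs : Tendsto (fun N => ∑ r ∈ Finset.range N, d r / a (r + 1)) atTop (𝓝 s)) :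
    (fun N => ∑ r ∈ Finset.range N, d r) =o[atTop] a := by
  set S : ℕ → ℝ := fun N => ∑ r ∈ Finset.range N, d r / a (r + 1) with hS
  have hSs : (fun N => S N - s) =o[atTop] fun _ => (1 : ℝ) := by
    rw [Asymptotics.isLittleO_one_iff]
    simpa using hs.sub_const s
  have hconst : ∀ c : ℝ, (fun _ : ℕ => c) =o[atTop] a := fun c =>
    Asymptotics.isLittleO_const_left.2 (Or.inr (by
      have := tendsto_norm_atTop_atTop.comp ha
      exact this))
  -- Summation by parts with the centred partial sums `S - s`, which tend to 0; what remains is a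
  -- weighted Cesàro mean.
  have hid : ∀ N, ∑ r ∈ Finset.range N, d r = a N * (S N - s) -
      ∑ r ∈ Finset.range N, (a (r + 1) - a r) * (S r - s) - a 0 * (S 0 - s) := by
    intro N
    induction N with
    | zero => simp
    | succ N ih =>
      have h1 : S (N + 1) = S N + d N / a (N + 1) := Finset.sum_range_succ _ _
      have h2 : d N = a (N + 1) * (d N / a (N + 1)) := by
        rw [mul_div_cancel₀ _ (ha0 (N + 1)).ne']
      rw [Finset.sum_range_succ, Finset.sum_range_succ, ih, h1]
      nth_rewrite 1 [h2]
      ring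
  have hsum : ∀ N, ∑ r ∈ Finset.range N, (a (r + 1) - a r) = a N - a 0 := fun N =>
    Finset.sum_range_sub a N
  have h1 : (fun N => a N * (S N - s)) =o[atTop] a := by
    simpa using (Asymptotics.isBigO_refl a atTop).mul_isLittleO hSs
  have h2 : (fun N => ∑ r ∈ Finset.range N, (a (r + 1) - a r) * (S r - s)) =o[atTop] a := by
    have h3 : (fun r => (a (r + 1) - a r) * (S r - s)) =o[atTop] fun r => a (r + 1) - a r := by
      simpa using (Asymptotics.isBigO_refl (fun r => a (r + 1) - a r) atTop).mul_isLittleO hSs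
    have h4 := h3.sum_range (fun r => sub_nonneg.2 (ham (Nat.le_succ r))) (by
      simp only [hsum]
      exact tendsto_atTop_add_const_right _ _ ha)
    refine h4.trans_isBigO ?_
    simp only [hsum]
    exact (Asymptotics.isBigO_refl a atTop).sub (hconst (a 0)).isBigO
  refine ((h1.sub h2).sub (hconst (a 0 * (S 0 - s)))).congr_left fun N => (hid N).symm

theorem tendsto_div_of_isLittleO {a b : ℕ → ℝ} (ha : ∀ n, 0 ≤ a n) (hb : Tendsto b atTop atTop)
    {α β : ℝ} (hα : 0 < α) (hβ : 0 < β)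
    (h : (fun n => α * a n - β * b n) =o[atTop] fun n => 1 + b n + a n) :
    Tendsto (fun n => a n / b n) atTop (𝓝 (β / α)) := by
  have hb1 : ∀ᶠ n in atTop, 1 ≤ b n := hb.eventually_ge_atTop 1
  -- The error is relative to `a` as well; with constant `α / 2` its share of `a` is absorbed on the
  -- left, so `a = O(b)`.
  have hO : (fun n => 1 + b n + a n) =O[atTop] b := by
    refine Asymptotics.IsBigO.of_bound (2 + (2 * β / α + 2)) ?_
    filter_upwards [hb1, h.bound (half_pos hα)] with n hn hbd
    rw [Real.norm_eq_abs, Real.norm_eq_abs,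
      abs_of_nonneg (show 0 ≤ 1 + b n + a n by linarith [ha n])] at hbd
    rw [Real.norm_eq_abs, Real.norm_eq_abs, abs_of_nonneg (by linarith [ha n]),
      abs_of_nonneg (by linarith)]
    have h1 := (abs_le.1 hbd).2
    have h2 : α * a n ≤ α * ((2 * β / α + 2) * b n) := by
      have e : α * ((2 * β / α + 2) * b n) = 2 * β * b n + 2 * α * b n := by
        field_simp
      rw [e]
      nlinarith
    have h3 := le_of_mul_le_mul_left h2 hα
    linarith
  have ht := (h.trans_isBigO hO).tendsto_div_nhds_zero
  have ht2 : Tendsto (fun n => ((α * a n - β * b n) / b n + β) / α) atTop (𝓝 ((0 + β) / α)) :=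
    (ht.add_const β).div_const α
  rw [zero_add] at ht2
  refine ht2.congr' ?_
  filter_upwards [hb1] with n hn
  have : b n ≠ 0 := by linarith
  field_simp
  ring

/-- The number of visits of the path `c` to `z` strictly before time `N`. -/
def visits (c : ℕ → ℤ × ℤ) (z : ℤ × ℤ) (N : ℕ) : ℝ :=
  ∑ r ∈ Finset.range N, if c r = z then 1 else 0

theorem visits_succ (c : ℕ → ℤ × ℤ) (z : ℤ × ℤ) (N : ℕ) :
    visits c z (N + 1) = visits c z N + if c N = z then 1 else 0 :=
  Finset.sum_range_succ _ _

theorem visits_mono (c : ℕ → ℤ × ℤ) (z : ℤ × ℤ) : Monotone (visits c z) := by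
  refine monotone_nat_of_le_succ fun N => ?_
  rw [visits_succ]
  split_ifs <;> linarith

theorem visits_nonneg (c : ℕ → ℤ × ℤ) (z : ℤ × ℤ) (N : ℕ) : 0 ≤ visits c z N :=
  Finset.sum_nonneg fun r _ => by split_ifs <;> norm_num

theorem tendsto_visits_atTop {c : ℕ → ℤ × ℤ} {z : ℤ × ℤ} (h : ∃ᶠ n in atTop, c n = z) :
    Tendsto (visits c z) atTop atTop := by
  refine tendsto_atTop_atTop_of_monotone (visits_mono c z) fun b => ?_
  obtain ⟨k, hk⟩ := exists_nat_ge b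
  suffices H : ∀ k : ℕ, ∃ N, (k : ℝ) ≤ visits c z N by
    obtain ⟨N, hN⟩ := H k
    exact ⟨N, hk.trans hN⟩
  intro k
  induction k with
  | zero => exact ⟨0, by simp [visits]⟩
  | succ k ih =>
    obtain ⟨N, hN⟩ := ih
    obtain ⟨n, hn, hcn⟩ := (frequently_atTop.1 h) N
    refine ⟨n + 1, ?_⟩
    rw [visits_succ, if_pos hcn]
    push_cast
    linarith [visits_mono c z hn]

/-- The discount weight `1 / (1 + number of earlier visits to x or y)`. -/
def visitWeight (c : ℕ → ℤ × ℤ) (x y : ℤ × ℤ) (N : ℕ) : ℝ :=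
  (1 + visits c x N + visits c y N)⁻¹

theorem visitWeight_pos (c : ℕ → ℤ × ℤ) (x y : ℤ × ℤ) (N : ℕ) : 0 < visitWeight c x y N := by
  have := visits_nonneg c x N
  have := visits_nonneg c y N
  unfold visitWeight
  positivity

theorem visitWeight_le_one (c : ℕ → ℤ × ℤ) (x y : ℤ × ℤ) (N : ℕ) : visitWeight c x y N ≤ 1 :=
  inv_le_one_of_one_le₀ (by linarith [visits_nonneg c x N, visits_nonneg c y N])

/-- The discrete form of `dt / t² = -d(1 / t)`: squared weights summed over visits telescope and
stay bounded. -/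
theorem visitWeight_sq_mul_le (c : ℕ → ℤ × ℤ) (x y : ℤ × ℤ) (N : ℕ) :
    visitWeight c x y (N + 1) ^ 2 * ((if c N = x then 1 else 0) + (if c N = y then 1 else 0)) ≤
      visitWeight c x y N - visitWeight c x y (N + 1) := by
  have hx := visits_nonneg c x N
  have hy := visits_nonneg c y N
  unfold visitWeight
  rw [visits_succ, visits_succ]
  set e : ℝ := (if c N = x then 1 else 0) + (if c N = y then 1 else 0) with he
  have he0 : 0 ≤ e := by
    rw [he]; split_ifs <;> norm_num
  set A := 1 + visits c x N + visits c y N with hA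
  have hA0 : 0 < A := by rw [hA]; linarith
  have e1 : 1 + (visits c x N + if c N = x then 1 else 0) +
      (visits c y N + if c N = y then 1 else 0) = A + e := by rw [hA, he]; ring
  rw [e1]
  have h2 : A⁻¹ - (A + e)⁻¹ - (A + e)⁻¹ ^ 2 * e = e ^ 2 / (A * (A + e) ^ 2) := by
    have : A + e ≠ 0 := by linarith
    field_simp
    ring
  have h3 : 0 ≤ e ^ 2 / (A * (A + e) ^ 2) := by positivity
  linarith

end Deterministic

/-! ### The discounted dipole martingale and its `L²` bound -/

section DipoleMartingale

variable {Ω : Type*} [MeasurableSpace Ω] {P : Measure Ω} [IsProbabilityMeasure P]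
  {p : ℤ → ℝ} {C : ℕ → Ω → ℤ × ℤ}

/-- The path of `C` at `ω`. -/
abbrev path (C : ℕ → Ω → ℤ × ℤ) (ω : Ω) (n : ℕ) : ℤ × ℤ := C n ω

/-- The discounted martingale transform attached to the function `h` and the points `x`, `y`. -/
def dipoleMartingale (p : ℤ → ℝ) (h : ℤ × ℤ → ℝ) (x y : ℤ × ℤ) (C : ℕ → Ω → ℤ × ℤ) (N : ℕ)
    (ω : Ω) : ℝ :=
  ∑ r ∈ Finset.range N,
    -- Index `r + 1` counts visits up to time `r` inclusive, so the weight is known before the step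
    -- it multiplies.
    visitWeight (path C ω) x y (r + 1) * (h (C (r + 1) ω) - stepOp p h (C r ω))

theorem isBddMeasurable_visitWeight (hC : ∀ n, Measurable (C n)) (x y : ℤ × ℤ) (N : ℕ) :
    IsBddMeasurable (historyFiltration C hC N) (fun ω => visitWeight (path C ω) x y (N + 1)) := by
  have hv : ∀ z, Measurable[historyFiltration C hC N] (fun ω => visits (path C ω) z (N + 1)) := by
    intro z
    refine Finset.measurable_sum _ fun r hr => ?_
    have hr' : r ≤ N := by
      have := Finset.mem_range.1 hr
      omega
    exact (measurable_of_countable (fun w : ℤ × ℤ => if w = z then (1 : ℝ) else 0)).comp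
      (measurable_historyFiltration hC hr')
  refine ⟨?_, 1, fun ω => ?_⟩
  · exact ((measurable_const.add (hv x)).add (hv y)).inv
  · rw [abs_of_pos (visitWeight_pos _ _ _ _)]
    exact visitWeight_le_one _ _ _ _

theorem isBddMeasurable_dipoleMartingale (hC : ∀ n, Measurable (C n)) (h0 : ∀ j, 0 ≤ p j)
    (h1 : ∀ j, p j ≤ 1 / 2) {h : ℤ × ℤ → ℝ} {K : ℝ} (hK : ∀ z, |h z| ≤ K) (x y : ℤ × ℤ) (N : ℕ) :
    IsBddMeasurable (historyFiltration C hC N) (dipoleMartingale p h x y C N) := by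
  refine IsBddMeasurable.sum _ fun r hr => ?_
  have hr' : r + 1 ≤ N := Finset.mem_range.1 hr
  refine IsBddMeasurable.mul ?_ (IsBddMeasurable.sub ?_ ?_)
  · exact (isBddMeasurable_visitWeight hC x y r).mono
      ((historyFiltration C hC).mono (by omega))
  · exact IsBddMeasurable.comp (measurable_historyFiltration hC hr') hK
  · exact IsBddMeasurable.comp (measurable_historyFiltration hC (by omega)) (abs_stepOp_le h0 h1 hK)

theorem IsAnisotropicWalk.martingale_dipoleMartingale (hC : IsAnisotropicWalk P p C)
    (h0 : ∀ j, 0 ≤ p j) (h1 : ∀ j, p j ≤ 1 / 2) {h : ℤ × ℤ → ℝ} {K : ℝ} (hK : ∀ z, |h z| ≤ K)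
    (x y : ℤ × ℤ) :
    Martingale (dipoleMartingale p h x y C) (historyFiltration C hC.measurable) P := by
  have hle := (historyFiltration C hC.measurable).le
  refine martingale_of_condExp_sub_eq_zero_nat
    (fun N => (isBddMeasurable_dipoleMartingale hC.measurable h0 h1 hK x y N).1.stronglyMeasurable)
    (fun N => ((isBddMeasurable_dipoleMartingale hC.measurable h0 h1 hK x y N).mono
      (hle N)).integrable) fun N => ?_
  have hd : dipoleMartingale p h x y C (N + 1) - dipoleMartingale p h x y C N =
      (fun ω => visitWeight (path C ω) x y (N + 1)) *
        ((fun ω => h (C (N + 1) ω)) - fun ω => stepOp p h (C N ω)) := by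
    ext ω
    simp [dipoleMartingale, Finset.sum_range_succ]
  have hi1 := integrable_comp_of_bounded (P := P) hK (hC.measurable (N + 1))
  have hT : IsBddMeasurable (historyFiltration C hC.measurable N)
      (fun ω => stepOp p h (C N ω)) :=
    IsBddMeasurable.comp (measurable_historyFiltration hC.measurable le_rfl)
      (abs_stepOp_le h0 h1 hK)
  have hi2 : Integrable (fun ω => stepOp p h (C N ω)) P := (hT.mono (hle N)).integrable
  obtain ⟨hwm, K', hwK⟩ := isBddMeasurable_visitWeight hC.measurable x y N
  rw [hd]
  refine (condExp_stronglyMeasurable_mul_of_bound (hle N) hwm.stronglyMeasurable (hi1.sub hi2) K'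
    (Eventually.of_forall hwK)).trans ?_
  have h2 := condExp_sub hi1 hi2 (historyFiltration C hC.measurable N)
  rw [condExp_of_stronglyMeasurable (hle N) hT.1.stronglyMeasurable hi2] at h2
  filter_upwards [h2, hC.condExp_comp h0 h1 hK N] with ω hω1 hω2
  simp [hω1, hω2]

theorem abs_dipole_le (h0 : ∀ j, 0 < p j) (x y z : ℤ × ℤ) :
    |dipole p x y z| ≤ ((reversibleWeight p x)⁻¹ + (reversibleWeight p y)⁻¹) *
      ((if z = x then 1 else 0) + (if z = y then 1 else 0)) := by
  have hx := inv_pos.2 (reversibleWeight_pos h0 x)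
  have hy := inv_pos.2 (reversibleWeight_pos h0 y)
  unfold dipole
  by_cases hzx : z = x
  · subst hzx
    by_cases hzy : z = y
    · subst hzy
      simp only [if_true, sub_self, zero_div, abs_zero]
      positivity
    · simp only [hzy, if_true, if_false, zero_sub, add_zero, mul_one, neg_div, abs_neg, one_div]
      rw [abs_of_pos hx]; linarith
  · by_cases hzy : z = y
    · subst hzy
      simp only [hzx, if_true, if_false, sub_zero, zero_add, mul_one, one_div]
      rw [abs_of_pos hy]; linarith
    · simp [hzx, hzy]

/-- Increments of `h` do not vanish away from `x` and `y`, but the conditional variance of `h (C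
(N+1))` is the conditional mean of `h (C (N+1))² - (T h (C N))²`. Replacing `T h` by `h` at `C N`
makes this telescope, up to the decrease of the weights; the replacement costs `(h + T h) * dipole`,
supported on `{x, y}` and summable by `visitWeight_sq_mul_le`. -/
theorem IsAnisotropicWalk.integral_dipoleMartingale_sq_le (hC : IsAnisotropicWalk P p C)
    (h0 : ∀ j, 0 < p j) (h1 : ∀ j, p j ≤ 1 / 2) {h : ℤ × ℤ → ℝ} {K : ℝ} (hK : ∀ z, |h z| ≤ K)
    {x y : ℤ × ℤ} (hh : ∀ z, h z - stepOp p h z = dipole p x y z) (N : ℕ) :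
    ∫ ω, dipoleMartingale p h x y C N ω ^ 2 ∂P ≤
      2 * K ^ 2 + 2 * K * ((reversibleWeight p x)⁻¹ + (reversibleWeight p y)⁻¹) := by
  have h0' : ∀ j, 0 ≤ p j := fun j => (h0 j).le
  have hle := (historyFiltration C hC.measurable).le
  set M := (reversibleWeight p x)⁻¹ + (reversibleWeight p y)⁻¹ with hM
  have hM0 : 0 < M := add_pos (inv_pos.2 (reversibleWeight_pos h0 x))
    (inv_pos.2 (reversibleWeight_pos h0 y))
  have hK0 : 0 ≤ K := (abs_nonneg _).trans (hK 0)
  set w : ℕ → Ω → ℝ := fun N ω => visitWeight (path C ω) x y N with hw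
  have hw0 : ∀ N ω, 0 < w N ω := fun N ω => visitWeight_pos _ _ _ _
  have hw1 : ∀ N ω, w N ω ≤ 1 := fun N ω => visitWeight_le_one _ _ _ _
  set W := dipoleMartingale p h x y C with hWdef
  set T := stepOp p h with hT
  have hTK : ∀ z, |T z| ≤ K := abs_stepOp_le h0' h1 hK
  have hsqK : ∀ z, h z ^ 2 ≤ K ^ 2 := fun z => sq_le_sq' (abs_le.1 (hK z)).1 (abs_le.1 (hK z)).2
  -- `R` dominates the second moment inductively: its terms are the current endpoint, the loss from
  -- decreasing squared weights, and the accumulated dipole cost.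
  set R : ℕ → Ω → ℝ := fun N ω =>
    w N ω ^ 2 * h (C N ω) ^ 2 + K ^ 2 * (1 - w N ω ^ 2) + 2 * K * M * (1 - w N ω) with hR
  have bW := fun N => (isBddMeasurable_dipoleMartingale hC.measurable h0' h1 hK x y N)
  have bw : ∀ N, IsBddMeasurable inferInstance (w N) := by
    intro N
    cases N with
    | zero => simpa [hw, visitWeight, visits] using IsBddMeasurable.const (1 : ℝ)
    | succ N => exact (isBddMeasurable_visitWeight hC.measurable x y N).mono (hle N)
  have bh : ∀ N, IsBddMeasurable inferInstance (fun ω => h (C N ω)) := fun N =>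
    IsBddMeasurable.comp (hC.measurable N) hK
  have bT : ∀ N, IsBddMeasurable inferInstance (fun ω => T (C N ω)) := fun N =>
    IsBddMeasurable.comp (hC.measurable N) hTK
  have bR : ∀ N, IsBddMeasurable inferInstance (R N) := fun N =>
    (((bw N).sq.mul (bh N).sq).add ((IsBddMeasurable.const _).mul
      ((IsBddMeasurable.const 1).sub (bw N).sq))).add
      ((IsBddMeasurable.const _).mul ((IsBddMeasurable.const 1).sub (bw N)))
  have hpath : ∀ N ω, R N ω + w (N + 1) ω ^ 2 * h (C (N + 1) ω) ^ 2 -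
      w (N + 1) ω ^ 2 * T (C N ω) ^ 2 ≤ R (N + 1) ω := by
    intro N ω
    have hv := visitWeight_sq_mul_le (path C ω) x y N
    change w (N + 1) ω ^ 2 * _ ≤ w N ω - w (N + 1) ω at hv
    set e : ℝ := (if path C ω N = x then 1 else 0) + (if path C ω N = y then 1 else 0) with he
    have he0 : 0 ≤ e := by rw [he]; split_ifs <;> norm_num
    have hφ : |dipole p x y (C N ω)| ≤ M * e := abs_dipole_le h0 x y (C N ω)
    have hdiff : 0 ≤ w N ω - w (N + 1) ω := le_trans (by positivity) hv
    have hsqw : w (N + 1) ω ^ 2 ≤ w N ω ^ 2 :=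
      pow_le_pow_left₀ (hw0 _ _).le (by linarith) 2
    have hTsq : h (C N ω) ^ 2 - T (C N ω) ^ 2 ≤ 2 * K * (M * e) := by
      have e1 : h (C N ω) ^ 2 - T (C N ω) ^ 2 =
          (h (C N ω) + T (C N ω)) * dipole p x y (C N ω) := by rw [← hh]; ring
      rw [e1]
      refine (le_abs_self _).trans ?_
      rw [abs_mul]
      refine mul_le_mul ?_ hφ (abs_nonneg _) (by positivity)
      exact (abs_add_le _ _).trans (by linarith [hK (C N ω), hTK (C N ω)])
    have hA : w (N + 1) ω ^ 2 * (h (C N ω) ^ 2 - T (C N ω) ^ 2) ≤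
        2 * K * M * (w N ω - w (N + 1) ω) := by
      calc w (N + 1) ω ^ 2 * (h (C N ω) ^ 2 - T (C N ω) ^ 2)
          ≤ w (N + 1) ω ^ 2 * (2 * K * (M * e)) := by gcongr
        _ = 2 * K * M * (w (N + 1) ω ^ 2 * e) := by ring
        _ ≤ _ := by gcongr
    have hB : (w N ω ^ 2 - w (N + 1) ω ^ 2) * h (C N ω) ^ 2 ≤
        (w N ω ^ 2 - w (N + 1) ω ^ 2) * K ^ 2 :=
      mul_le_mul_of_nonneg_left (hsqK _) (by linarith)
    simp only [hR]
    linarith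
  have hmain : ∀ N, ∫ ω, W N ω ^ 2 ∂P ≤ ∫ ω, R N ω ∂P := by
    intro N
    induction N with
    | zero =>
      refine integral_mono ((bW 0).mono (hle 0)).sq.integrable (bR 0).integrable fun ω => ?_
      simp only [hWdef, dipoleMartingale, Finset.range_zero, Finset.sum_empty, hR]
      have hs : w 0 ω = 1 := by simp [hw, visitWeight, visits]
      rw [hs]
      nlinarith [sq_nonneg (h (C 0 ω))]
    | succ N ih =>
      obtain ⟨hgm, Kg, hgK⟩ := (((bW N).mono le_rfl).mul
        (isBddMeasurable_visitWeight hC.measurable x y N))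
      have c1 := hC.integral_mul_comp h0' h1 hK hgm hgK
      obtain ⟨hgm2, Kg2, hgK2⟩ := ((isBddMeasurable_visitWeight hC.measurable x y N).sq.mul
        (IsBddMeasurable.comp (measurable_historyFiltration hC.measurable le_rfl) hTK))
      have c2 := hC.integral_mul_comp h0' h1 hK hgm2 hgK2
      have bWN : IsBddMeasurable inferInstance (W N) := (bW N).mono (hle N)
      have i1 := bWN.sq.integrable (P := P)
      have i2 := ((bWN.mul (bw (N + 1))).mul (bh (N + 1))).integrable (P := P)
      have i3 := ((bWN.mul (bw (N + 1))).mul (bT N)).integrable (P := P)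
      have i4 := ((bw (N + 1)).sq.mul (bh (N + 1)).sq).integrable (P := P)
      have i5 := (((bw (N + 1)).sq.mul (bT N)).mul (bh (N + 1))).integrable (P := P)
      have i6 := (((bw (N + 1)).sq.mul (bT N)).mul (bT N)).integrable (P := P)
      have iR := (bR N).integrable (P := P)
      have iR' := (bR (N + 1)).integrable (P := P)
      have hexp : ∀ ω, W (N + 1) ω ^ 2 = W N ω ^ 2 + 2 * (W N ω * w (N + 1) ω * h (C (N + 1) ω)) -
          2 * (W N ω * w (N + 1) ω * T (C N ω)) + w (N + 1) ω ^ 2 * h (C (N + 1) ω) ^ 2 -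
          2 * (w (N + 1) ω ^ 2 * T (C N ω) * h (C (N + 1) ω)) +
          w (N + 1) ω ^ 2 * T (C N ω) * T (C N ω) := by
        intro ω
        have : W (N + 1) ω = W N ω + w (N + 1) ω * (h (C (N + 1) ω) - T (C N ω)) :=
          Finset.sum_range_succ _ _
        rw [this]; ring
      have hI : ∫ ω, W (N + 1) ω ^ 2 ∂P = ∫ ω, W N ω ^ 2 ∂P +
          2 * ∫ ω, W N ω * w (N + 1) ω * h (C (N + 1) ω) ∂P -
          2 * ∫ ω, W N ω * w (N + 1) ω * T (C N ω) ∂P +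
          ∫ ω, w (N + 1) ω ^ 2 * h (C (N + 1) ω) ^ 2 ∂P -
          2 * ∫ ω, w (N + 1) ω ^ 2 * T (C N ω) * h (C (N + 1) ω) ∂P +
          ∫ ω, w (N + 1) ω ^ 2 * T (C N ω) * T (C N ω) ∂P := by
        simp_rw [hexp]
        rw [integral_add (by fun_prop) (by fun_prop), integral_sub (by fun_prop) (by fun_prop),
          integral_add (by fun_prop) (by fun_prop), integral_sub (by fun_prop) (by fun_prop),
          integral_add (by fun_prop) (by fun_prop), integral_const_mul, integral_const_mul,
          integral_const_mul]
      have hfin : ∫ ω, R N ω ∂P + ∫ ω, w (N + 1) ω ^ 2 * h (C (N + 1) ω) ^ 2 ∂P -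
          ∫ ω, w (N + 1) ω ^ 2 * T (C N ω) * T (C N ω) ∂P ≤ ∫ ω, R (N + 1) ω ∂P := by
        rw [← integral_add iR i4, ← integral_sub (by fun_prop) i6]
        refine integral_mono (by fun_prop) iR' fun ω => ?_
        have := hpath N ω
        simp only
        linarith [this, show w (N + 1) ω ^ 2 * T (C N ω) * T (C N ω) =
          w (N + 1) ω ^ 2 * T (C N ω) ^ 2 by ring]
      change ∫ ω, W N ω * w (N + 1) ω * h (C (N + 1) ω) ∂P =
        ∫ ω, W N ω * w (N + 1) ω * T (C N ω) ∂P at c1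
      change ∫ ω, w (N + 1) ω ^ 2 * T (C N ω) * h (C (N + 1) ω) ∂P =
        ∫ ω, w (N + 1) ω ^ 2 * T (C N ω) * T (C N ω) ∂P at c2
      rw [hI, c1, c2]
      linarith
  refine (hmain N).trans ?_
  have : ∫ ω, R N ω ∂P ≤ ∫ _, (2 * K ^ 2 + 2 * K * M) ∂P := by
    refine integral_mono (bR N).integrable (integrable_const _) fun ω => ?_
    have a1 : w N ω ^ 2 * h (C N ω) ^ 2 ≤ 1 * K ^ 2 :=
      mul_le_mul (pow_le_one₀ (hw0 N ω).le (hw1 N ω)) (hsqK _) (sq_nonneg _) zero_le_one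
    have a2 : K ^ 2 * (1 - w N ω ^ 2) ≤ K ^ 2 * 1 := by
      gcongr
      linarith [sq_nonneg (w N ω)]
    have a3 : 2 * K * M * (1 - w N ω) ≤ 2 * K * M * 1 := by
      gcongr
      linarith [hw0 N ω]
    simp only [hR]
    linarith
  simpa using this

theorem IsAnisotropicWalk.ae_tendsto_dipoleMartingale (hC : IsAnisotropicWalk P p C)
    (h0 : ∀ j, 0 < p j) (h1 : ∀ j, p j ≤ 1 / 2) {h : ℤ × ℤ → ℝ} {K : ℝ} (hK : ∀ z, |h z| ≤ K)
    {x y : ℤ × ℤ} (hh : ∀ z, h z - stepOp p h z = dipole p x y z) :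
    ∀ᵐ ω ∂P, ∃ s, Tendsto (fun N => dipoleMartingale p h x y C N ω) atTop (𝓝 s) := by
  have h0' : ∀ j, 0 ≤ p j := fun j => (h0 j).le
  set R := 2 * K ^ 2 + 2 * K * ((reversibleWeight p x)⁻¹ + (reversibleWeight p y)⁻¹)
  refine (hC.martingale_dipoleMartingale h0' h1 hK x y).submartingale.exists_ae_tendsto_of_bdd
    (R := (1 + R).toNNReal) fun N => ?_
  have bW := (isBddMeasurable_dipoleMartingale hC.measurable h0' h1 hK x y N).mono
    ((historyFiltration C hC.measurable).le N)
  have hi := bW.integrable (P := P)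
  rw [eLpNorm_one_eq_lintegral_enorm, ← ofReal_integral_norm_eq_lintegral_enorm hi]
  refine ENNReal.ofReal_le_ofReal ?_
  calc ∫ ω, ‖dipoleMartingale p h x y C N ω‖ ∂P
      ≤ ∫ ω, (1 + dipoleMartingale p h x y C N ω ^ 2) ∂P := by
        refine integral_mono hi.norm ((IsBddMeasurable.const 1).add bW.sq).integrable fun ω => ?_
        simp only [Real.norm_eq_abs]
        rw [abs_le]
        constructor <;> nlinarith [sq_nonneg (dipoleMartingale p h x y C N ω - 1),
          sq_nonneg (dipoleMartingale p h x y C N ω + 1)]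
    _ = 1 + ∫ ω, dipoleMartingale p h x y C N ω ^ 2 ∂P := by
        rw [integral_add (integrable_const _) bW.sq.integrable]
        simp
    _ ≤ 1 + R := by
        gcongr
        exact hC.integral_dipoleMartingale_sq_le h0 h1 hK hh N

end DipoleMartingale
end

/-! ### Ratio limits for visit counts -/

noncomputable section

section Ratio

variable {Ω : Type*} [MeasurableSpace Ω] {P : Measure Ω} [IsProbabilityMeasure P]
  {p : ℤ → ℝ} {C : ℕ → Ω → ℤ × ℤ}

theorem sum_dipole (x y : ℤ × ℤ) (c : ℕ → ℤ × ℤ) (N : ℕ) :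
    ∑ r ∈ Finset.range N, dipole p x y (c r) =
      (reversibleWeight p y)⁻¹ * visits c y N - (reversibleWeight p x)⁻¹ * visits c x N := by
  rw [visits, visits, Finset.mul_sum, Finset.mul_sum, ← Finset.sum_sub_distrib]
  refine Finset.sum_congr rfl fun r _ => ?_
  unfold dipole
  by_cases hx : c r = x <;> by_cases hy : c r = y
  · have : x = y := hx.symm.trans hy
    subst this
    simp [hx]
  · subst hx
    simp [hy, neg_div]
  · subst hy
    simp [hx]
  · simp [hx, hy]

/-- Almost surely, if `x` is visited infinitely often, then the ratio of the numbers of visits to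
`y` and to `x` converges to the ratio of their reversible weights. -/
def HasVisitRatio (P : Measure Ω) (p : ℤ → ℝ) (C : ℕ → Ω → ℤ × ℤ) (x y : ℤ × ℤ) : Prop :=
  ∀ᵐ ω ∂P, Tendsto (visits (path C ω) x) atTop atTop →
    Tendsto (fun N => visits (path C ω) y N / visits (path C ω) x N) atTop
      (𝓝 (reversibleWeight p y / reversibleWeight p x))

theorem IsAnisotropicWalk.hasVisitRatio_of_step (hC : IsAnisotropicWalk P p C)
    (h0 : ∀ j, 0 < p j) (h1 : ∀ j, p j ≤ 1 / 2) {x y : ℤ × ℤ} (hxy : 0 < anisotropicStep p x y) :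
    HasVisitRatio P p C x y := by
  obtain ⟨h, K, hK, hh⟩ := exists_bounded_dipole h0 h1 hxy
  filter_upwards [hC.ae_tendsto_dipoleMartingale h0 h1 hK hh] with ω ⟨s, hs⟩ hx
  set c := path C ω with hc
  set a : ℕ → ℝ := fun N => 1 + visits c x N + visits c y N with ha
  have ha0 : ∀ n, 0 < a n := fun n => by
    have := visits_nonneg c x n
    have := visits_nonneg c y n
    simp only [ha]; linarith
  have ham : Monotone a := fun m n hmn => by
    have := visits_mono c x hmn
    have := visits_mono c y hmn
    simp only [ha]; linarith
  have hat : Tendsto a atTop atTop :=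
    tendsto_atTop_mono (fun n => by
      have := visits_nonneg c y n
      simp only [ha]; linarith) hx
  have hkr := kronecker_isLittleO (d := fun r => h (C (r + 1) ω) - stepOp p h (C r ω)) ha0 ham hat
    (s := s) (hs.congr fun N => Finset.sum_congr rfl fun r _ => by
      rw [visitWeight, div_eq_inv_mul])
  -- Each summand is the increment of `h` plus `h - T h = dipole` at `C r`: a bounded telescoping
  -- part plus the weighted visit difference.
  have hid : ∀ N, ∑ r ∈ Finset.range N, (h (C (r + 1) ω) - stepOp p h (C r ω)) =
      (h (C N ω) - h (C 0 ω)) + ((reversibleWeight p y)⁻¹ * visits c y N -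
        (reversibleWeight p x)⁻¹ * visits c x N) := by
    intro N
    rw [← sum_dipole, ← Finset.sum_range_sub (fun r => h (C r ω)), ← Finset.sum_add_distrib]
    refine Finset.sum_congr rfl fun r _ => ?_
    rw [← hh]
    simp only [hc, path]
    ring
  have hbd : (fun N => h (C N ω) - h (C 0 ω)) =o[atTop] a := by
    have h2 : (fun N => h (C N ω) - h (C 0 ω)) =O[atTop] fun _ : ℕ => (1 : ℝ) := by
      refine Asymptotics.IsBigO.of_bound (2 * K) (Eventually.of_forall fun N => ?_)
      rw [norm_one, mul_one, Real.norm_eq_abs]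
      refine (abs_sub _ _).trans ?_
      linarith [hK (C N ω), hK (C 0 ω)]
    refine h2.trans_isLittleO (Asymptotics.isLittleO_const_left.2 (Or.inr ?_))
    exact tendsto_norm_atTop_atTop.comp hat
  have hlo : (fun N => (reversibleWeight p y)⁻¹ * visits c y N -
      (reversibleWeight p x)⁻¹ * visits c x N) =o[atTop] a :=
    (hkr.sub hbd).congr_left fun N => by rw [hid]; ring
  have := tendsto_div_of_isLittleO (visits_nonneg c y) hx
    (inv_pos.2 (reversibleWeight_pos h0 y)) (inv_pos.2 (reversibleWeight_pos h0 x)) hlo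
  convert this using 2
  rw [div_inv_eq_mul, mul_comm, div_eq_mul_inv]

theorem tendsto_visits_of_ratio (h0 : ∀ j, 0 < p j) {c : ℕ → ℤ × ℤ} {x y : ℤ × ℤ}
    (hx : Tendsto (visits c x) atTop atTop)
    (h : Tendsto (fun N => visits c y N / visits c x N) atTop
      (𝓝 (reversibleWeight p y / reversibleWeight p x))) :
    Tendsto (visits c y) atTop atTop := by
  have := h.pos_mul_atTop (div_pos (reversibleWeight_pos h0 y) (reversibleWeight_pos h0 x)) hx
  refine this.congr' ?_
  filter_upwards [hx.eventually_gt_atTop 0] with N hN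
  exact div_mul_cancel₀ _ hN.ne'

/-- The limiting ratio is positive, so infinitely many visits to `x` force infinitely many to `y`,
which activates the second ratio. -/
theorem HasVisitRatio.trans (h0 : ∀ j, 0 < p j) {x y z : ℤ × ℤ} (hxy : HasVisitRatio P p C x y)
    (hyz : HasVisitRatio P p C y z) : HasVisitRatio P p C x z := by
  filter_upwards [hxy, hyz] with ω h1 h2 hx
  have hy := tendsto_visits_of_ratio h0 hx (h1 hx)
  have := (h2 hy).mul (h1 hx)
  rw [div_mul_div_cancel₀ (reversibleWeight_pos h0 y).ne'] at this
  refine this.congr' ?_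
  filter_upwards [hy.eventually_gt_atTop 0] with N hN
  exact div_mul_div_cancel₀ hN.ne'

theorem HasVisitRatio.refl (h0 : ∀ j, 0 < p j) (x : ℤ × ℤ) : HasVisitRatio P p C x x := by
  refine Eventually.of_forall fun ω hx => ?_
  rw [div_self (reversibleWeight_pos h0 x).ne']
  refine tendsto_const_nhds.congr' ?_
  filter_upwards [hx.eventually_gt_atTop 0] with N hN
  exact (div_self hN.ne').symm

/-- Horizontal moves may be impossible in other rows, as on the comb, so points are joined through
row 0, where `p 0 < 1/2` permits them. Reversibility makes each link usable in both directions. -/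
theorem IsAnisotropicWalk.hasVisitRatio (hC : IsAnisotropicWalk P p C)
    (h0 : ∀ j, 0 < p j) (h1 : ∀ j, p j ≤ 1 / 2) (hp : p 0 < 1 / 2) (x y : ℤ × ℤ) :
    HasVisitRatio P p C x y := by
  have hadj : ∀ z w, 0 < anisotropicStep p z w → HasVisitRatio P p C z w ∧
      HasVisitRatio P p C w z := by
    intro z w hzw
    refine ⟨hC.hasVisitRatio_of_step h0 h1 hzw, hC.hasVisitRatio_of_step h0 h1 ?_⟩
    have h2 := reversibleWeight_mul_step_comm h0 z w
    have h3 := mul_pos (reversibleWeight_pos h0 z) hzw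
    rw [h2] at h3
    exact pos_of_mul_pos_right h3 (reversibleWeight_pos h0 w).le
  have hvert : ∀ k j, HasVisitRatio P p C (k, j) (k, j + 1) ∧
      HasVisitRatio P p C (k, j + 1) (k, j) := by
    intro k j
    refine hadj _ _ ?_
    simp [anisotropicStep, h0 j]
  have hhor : ∀ k, HasVisitRatio P p C (k, 0) (k + 1, 0) ∧
      HasVisitRatio P p C (k + 1, 0) (k, 0) := by
    intro k
    refine hadj _ _ ?_
    simp only [anisotropicStep, true_or, if_true]
    linarith
  have hrow : ∀ k : ℤ, HasVisitRatio P p C (0, 0) (k, 0) ∧ HasVisitRatio P p C (k, 0) (0, 0) := by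
    intro k
    induction k using Int.induction_on with
    | zero => exact ⟨HasVisitRatio.refl h0 _, HasVisitRatio.refl h0 _⟩
    | succ i ih => exact ⟨ih.1.trans h0 (hhor _).1, (hhor _).2.trans h0 ih.2⟩
    | pred i ih =>
      have := hhor (-(i : ℤ) - 1)
      rw [sub_add_cancel] at this
      exact ⟨ih.1.trans h0 this.2, this.1.trans h0 ih.2⟩
  have hcol : ∀ k j : ℤ, HasVisitRatio P p C (0, 0) (k, j) ∧
      HasVisitRatio P p C (k, j) (0, 0) := by
    intro k j
    induction j using Int.induction_on with
    | zero => exact hrow k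
    | succ i ih => exact ⟨ih.1.trans h0 (hvert _ _).1, (hvert _ _).2.trans h0 ih.2⟩
    | pred i ih =>
      have := hvert k (-(i : ℤ) - 1)
      rw [sub_add_cancel] at this
      exact ⟨ih.1.trans h0 this.2, this.1.trans h0 ih.2⟩
  exact (hcol x.1 x.2).2.trans h0 (hcol y.1 y.2).1

theorem IsAnisotropicWalk.ae_tendsto_localTime_div (hC : IsAnisotropicWalk P p C)
    (h0 : ∀ j, 0 < p j) (h1 : ∀ j, p j ≤ 1 / 2) (hp : p 0 < 1 / 2)
    (hrec : ∀ᵐ ω ∂P, ∃ z, ∃ᶠ n in atTop, C n ω = z) (x y : ℤ × ℤ) :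
    ∀ᵐ ω ∂P, Tendsto (fun N => (localTime C x N ω : ℝ) / (localTime C y N ω : ℝ)) atTop
      (𝓝 (reversibleWeight p x / reversibleWeight p y)) := by
  have hall : ∀ᵐ ω ∂P, ∀ z : ℤ × ℤ, Tendsto (visits (path C ω) z) atTop atTop →
      Tendsto (fun N => visits (path C ω) y N / visits (path C ω) z N) atTop
        (𝓝 (reversibleWeight p y / reversibleWeight p z)) :=
    ae_all_iff.2 fun z => hC.hasVisitRatio h0 h1 hp z y
  filter_upwards [hrec, hall, hC.hasVisitRatio h0 h1 hp y x] with ω ⟨z, hz⟩ hω hxy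
  have hzt : Tendsto (visits (path C ω) z) atTop atTop := tendsto_visits_atTop hz
  have hlim := hxy (tendsto_visits_of_ratio h0 hzt (hω z hzt))
  -- `localTime` includes time `N`, whereas `visits` stops strictly before its argument; hence the
  -- shift.
  have hl : ∀ u N, (localTime C u N ω : ℝ) = visits (path C ω) u (N + 1) := by
    intro u N
    simp [localTime, visits, path]
  simp only [hl]
  exact (tendsto_add_atTop_iff_nat 1).2 hlim

end Ratio

end

/-! ### Specialisation to the half-plane half-comb walk -/

theorem corollary4p1 {Ω : Type*} [MeasurableSpace Ω] (P : Measure Ω) [IsProbabilityMeasure P]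
    (C : ℕ → Ω → ℤ × ℤ) (hC : IsHPHCWalk P C) (k₁ k₂ j₁ j₂ : ℤ) :
    ((0 ≤ j₁ ∧ 0 ≤ j₂) ∨ (j₁ < 0 ∧ j₂ < 0) →
      ∀ᵐ ω ∂P, Tendsto
        (fun N : ℕ => (localTime C (k₁, j₁) N ω : ℝ) / (localTime C (k₂, j₂) N ω : ℝ))
        atTop (𝓝 1)) ∧
    (0 ≤ j₁ ∧ j₂ < 0 →
      ∀ᵐ ω ∂P, Tendsto
        (fun N : ℕ => (localTime C (k₁, j₁) N ω : ℝ) / (localTime C (k₂, j₂) N ω : ℝ))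
        atTop (𝓝 2)) := by
  have h0 : ∀ j, 0 < hphcParam j := fun j => by
    unfold hphcParam; split_ifs <;> norm_num
  have h1 : ∀ j, hphcParam j ≤ 1 / 2 := fun j => by
    unfold hphcParam; split_ifs <;> norm_num
  have hp : hphcParam 0 < 1 / 2 := by norm_num [hphcParam]
  have hW : IsAnisotropicWalk P hphcParam C := hC
  have hrec := hW.ae_exists_frequently_visited (fun j => (h0 j).le) h1 hphcLyapunov_nonneg
    (fun z hz => stepOp_hphcLyapunov_le hz) finite_hphcLyapunov_le
  have hmain := hW.ae_tendsto_localTime_div h0 h1 hp hrec (k₁, j₁) (k₂, j₂)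
  constructor
  · rintro (⟨ha, hb⟩ | ⟨ha, hb⟩)
    · simpa [reversibleWeight, hphcParam, ha, hb] using hmain
    · simpa [reversibleWeight, hphcParam, ha.not_ge, hb.not_ge] using hmain
  · rintro ⟨ha, hb⟩
    have : reversibleWeight hphcParam (k₁, j₁) / reversibleWeight hphcParam (k₂, j₂) = 2 := by
      simp only [reversibleWeight, hphcParam, ha, hb.not_ge, if_true, if_false]
      norm_num
    rwa [this] at hmain
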